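/- Let $k\ge 1$, $\mathbf n=(n_1,\dots,n_k)$ with $n_i\ge 1$. Let $\mathbb F_{n}^+$ be the free unital semigroup on $g_1,\dots,g_{n}$; $|\alpha|$ is the length and $\widetilde\alpha$ the reverse of a word $\alpha$, and for operators $Y_1,\dots,Y_n$ and $\alpha=g_{j_1}\cdots g_{j_p}$ put $Y_\alpha=Y_{j_1}\cdots Y_{j_p}$. For $m\in\mathbb Z$ put $m^+=\max(m,0)$, $m^-=\max(-m,0)$. For a complex Hilbert space $\mathcal H$ let $\mathbf B_{\mathbf n}(\mathcal H)$ be the regular polyball, the set of all $\mathbf X=(X_1,\dots,X_k)$, $X_i=(X_{i,1},\dots,X_{i,n_i})\in B(\mathcal H)^{n_i}$, such that the entries of $X_s$ commute with those of $X_t$ for $s\ne t$, $\|\sum_j X_{i,j}X_{i,j}^*\|<1$ for every $i$, and $\boldsymbol\Delta_{\mathbf X}(I)$ is positive and invertible, where $\boldsymbol\Delta_{\mathbf X}=(\mathrm{id}-\Phi_{X_1})\circ\cdots\circ(\mathrm{id}-\Phi_{X_k})$ and $\Phi_{X_i}(Y)=\sum_j X_{i,j}YX_{i,j}^*$. A function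 $F$ that assigns to each $\mathbf X\in\mathbf B_{\mathbf n}(\mathcal H)$, for each Hilbert space $\mathcal H$, an operator $F(\mathbf X)\in B(\mathcal E\otimes\mathcal H)$ is called free $k$-pluriharmonic with coefficients in $B(\mathcal E)$ if there are $A_{(\boldsymbol\alpha;\boldsymbol\beta)}\in B(\mathcal E)$, independent of $\mathcal H$ and $\mathbf X$, with $$F(\mathbf X)=\sum_{m\in\mathbb Z^k}\ \sum_{\substack{\alpha_i,\beta_i\in\mathbb F_{n_i}^+\\ |\alpha_i|=m_i^-,\ |\beta_i|=m_i^+}}A_{(\boldsymbol\alpha;\boldsymbol\beta)}\otimes X_{1,\alpha_1}\cdots X_{k,\alpha_k}X_{1,\beta_1}^*\cdots X_{k,\beta_k}^*,$$ the series over $m\in\mathbb Z^k$ of the finite inner sums being unconditionally convergent in the operator norm for all such $\mathbf X$. It is positive if $F(\mathbf X)\ge 0$ for all such $\mathbf X$. Let $\mathcal F=F^2(H_{n_1})\otimes\cdots\otimes F^2(H_{n_k})$ be the tensor product of full Fock spaces, with orthonormal basis $e_{\alpha_1}\otimes\cdots\otimes e_{\alpha_k}$, let $\mathbf R_{i,j}$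 be the right creation operators on $\mathcal F$, $\mathbf R_{i,j}(e_{\alpha_1}\otimes\cdots\otimes e_{\alpha_k})=e_{\alpha_1}\otimes\cdots\otimes e_{\alpha_ig_j}\otimes\cdots\otimes e_{\alpha_k}$, and let $\boldsymbol{\mathcal R}_{\mathbf n}^*\boldsymbol{\mathcal R}_{\mathbf n}$ be the linear span of the operators $\mathbf R_{\boldsymbol\alpha}^*\mathbf R_{\boldsymbol\beta}$, where $\mathbf R_{\boldsymbol\alpha}=\mathbf R_{1,\alpha_1}\cdots\mathbf R_{k,\alpha_k}$. The free pluriharmonic Poisson kernel $\boldsymbol{\mathcal P}(\mathbf R,\mathbf X)\in B(\mathcal F\otimes\mathcal H)$ is the sum of the series above with coefficients $$A_{(\boldsymbol\alpha;\boldsymbol\beta)}=\mathbf R_{1,\widetilde\alpha_1}^*\cdots\mathbf R_{k,\widetilde\alpha_k}^*\mathbf R_{1,\widetilde\beta_1}\cdots\mathbf R_{k,\widetilde\beta_k}.$$ For a space of operators $V\subseteq B(\mathcal F)$, $V\otimes_{min}B(\mathcal H)$ is the norm closure in $B(\mathcal F\otimes\mathcal H)$ of the span of all $A\otimes Y$,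 $A\in V$, $Y\in B(\mathcal H)$ (replacing $V$ by its norm closure does not change it); similarly for $B(\mathcal E)\otimes_{min}B(\mathcal H)$. For a completely bounded linear map $\mu:V\to B(\mathcal E)$, $\widehat\mu:V\otimes_{min}B(\mathcal H)\to B(\mathcal E)\otimes_{min}B(\mathcal H)$ is the unique bounded linear map with $\widehat\mu(A\otimes Y)=\mu(A)\otimes Y$, and the Berezin transform of $\mu$ is $\boldsymbol{\mathcal B}_\mu(A,\mathbf X)=\widehat\mu[C_{\mathbf X}^*(A\otimes I)C_{\mathbf X}]$ whenever the operator in brackets lies in the domain of $\widehat\mu$. Here $$C_{\mathbf X}=(I\otimes\boldsymbol\Delta_{\mathbf X}(I)^{1/2})\prod_{i=1}^k\Big(I-\sum_{j=1}^{n_i}\mathbf R_{i,j}\otimes X_{i,j}^*\Big)^{-1}.$$ When $V=\boldsymbol{\mathcal R}_{\mathbf n}^*\boldsymbol{\mathcal R}_{\mathbf n}$, the Poisson transform of $\mu$ is $(\boldsymbol{\mathcal P}\mu)(\mathbf X)=\widehat\mu[\boldsymbol{\mathcal P}(\mathbf R,\mathbf X)]$. **Theorem.** Let $\mathcal E$ be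 a complex Hilbert space and $\mu:\boldsymbol{\mathcal R}_{\mathbf n}^*\boldsymbol{\mathcal R}_{\mathbf n}\to B(\mathcal E)$ a completely bounded linear map. (i) The series defining $\boldsymbol{\mathcal P}(\mathbf R,\mathbf X)$ converges unconditionally in norm for every $\mathbf X\in\mathbf B_{\mathbf n}(\mathcal H)$ and every $\mathcal H$, and $\mathbf X\mapsto\boldsymbol{\mathcal P}(\mathbf R,\mathbf X)$ is a positive free $k$-pluriharmonic function with coefficients in $B(\mathcal F)$. The operators $I-\sum_j\mathbf R_{i,j}\otimes X_{i,j}^*$ are invertible, and $\boldsymbol{\mathcal P}(\mathbf R,\mathbf X)=C_{\mathbf X}^*C_{\mathbf X}$. (ii) $\widehat\mu$ exists and $\boldsymbol{\mathcal P}(\mathbf R,\mathbf X)$ lies in its domain. The Poisson transform $\boldsymbol{\mathcal P}\mu$ is a free $k$-pluriharmonic function with coefficients in $B(\mathcal E)$, and $\boldsymbol{\mathcal P}\mu(\mathbf X)=\boldsymbol{\mathcal B}_\mu(I,\mathbf X)$ for all $\mathbf X$. Also $\boldsymbol{\mathcal P}\mu(\mathbf X)=\boldsymbol{\mathcal B}_\nu(I,\mathbf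 X)$ for every completely bounded linear map $\nu:B(\mathcal F)\to B(\mathcal E)$ that extends $\mu$. (iii) If, in addition, $\mu$ is completely positive, then $\boldsymbol{\mathcal P}\mu$ is a positive free $k$-pluriharmonic function. -/

import Mathlib

open scoped TensorProduct

universe u v

namespace Polyball

noncomputable section

/-! ### Hilbert tensor products and tensor products of operators -/

/-- The Hilbert space tensor product: the completion of the algebraic tensor product with respect
to `⟪x ⊗ y, x' ⊗ y'⟫ = ⟪x, x'⟫ ⟪y, y'⟫`. -/
abbrev HTensor (E : Type*) (H : Type*) [NormedAddCommGroup E] [InnerProductSpace ℂ E]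
    [NormedAddCommGroup H] [InnerProductSpace ℂ H] : Type _ :=
  UniformSpace.Completion (E ⊗[ℂ] H)

/-- The operator `A ⊗ Y` on the Hilbert tensor product. -/
def opTensor {E : Type*} {H : Type*} [NormedAddCommGroup E] [InnerProductSpace ℂ E]
    [NormedAddCommGroup H] [InnerProductSpace ℂ H] (A : E →L[ℂ] E) (Y : H →L[ℂ] H) :
    HTensor E H →L[ℂ] HTensor E H :=
  (TensorProduct.mapL A Y).completion

/-- `(A ⊗ Y)(x ⊗ h) = A x ⊗ Y h`. -/
theorem opTensor_tmul {E : Type*} {H : Type*} [NormedAddCommGroup E] [InnerProductSpace ℂ E]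
    [NormedAddCommGroup H] [InnerProductSpace ℂ H] (A : E →L[ℂ] E) (Y : H →L[ℂ] H)
    (x : E) (h : H) :
    opTensor A Y ((x ⊗ₜ[ℂ] h : E ⊗[ℂ] H) : HTensor E H) =
      ((A x ⊗ₜ[ℂ] Y h : E ⊗[ℂ] H) : HTensor E H) := by
  simp [opTensor]

/-- The minimal (spatial) tensor product `V ⊗_min B(H)` of a space of operators `V ⊆ B(E)` with
`B(H)`: the norm closure in `B(E ⊗ H)` of the linear span of the operators `A ⊗ Y`.  It does not
change when `V` is replaced by its norm closure. -/
def minTensor {E : Type*} [NormedAddCommGroup E] [InnerProductSpace ℂ E]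
    (V : Submodule ℂ (E →L[ℂ] E)) (H : Type*) [NormedAddCommGroup H] [InnerProductSpace ℂ H] :
    Submodule ℂ (HTensor E H →L[ℂ] HTensor E H) :=
  (Submodule.span ℂ {T | ∃ A ∈ V, ∃ Y : H →L[ℂ] H, T = opTensor A Y}).topologicalClosure

theorem opTensor_mem_minTensor {E : Type*} [NormedAddCommGroup E] [InnerProductSpace ℂ E]
    {V : Submodule ℂ (E →L[ℂ] E)} {H : Type*} [NormedAddCommGroup H] [InnerProductSpace ℂ H]
    (A : V) (Y : H →L[ℂ] H) : opTensor (A : E →L[ℂ] E) Y ∈ minTensor V H :=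
  Submodule.le_topologicalClosure _ (Submodule.subset_span ⟨A, A.2, Y, rfl⟩)

/-! ### Completely bounded and completely positive maps -/

/-- A matrix `[a i j]` of operators on `E`, as an operator on the direct sum `E^(m)`. -/
def opMatrix {E : Type*} [NormedAddCommGroup E] [InnerProductSpace ℂ E] {m : ℕ}
    (a : Fin m → Fin m → (E →L[ℂ] E)) :
    PiLp 2 (fun _ : Fin m => E) →L[ℂ] PiLp 2 (fun _ : Fin m => E) :=
  (PiLp.continuousLinearEquiv 2 ℂ (fun _ : Fin m => E)).symm.toContinuousLinearMap ∘L
    ContinuousLinearMap.pi (fun i => ∑ j, a i j ∘L ContinuousLinearMap.proj j) ∘L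
    (PiLp.continuousLinearEquiv 2 ℂ (fun _ : Fin m => E)).toContinuousLinearMap

theorem opMatrix_apply {E : Type*} [NormedAddCommGroup E] [InnerProductSpace ℂ E] {m : ℕ}
    (a : Fin m → Fin m → (E →L[ℂ] E)) (x : PiLp 2 (fun _ : Fin m => E)) (i : Fin m) :
    opMatrix a x i = ∑ j, a i j (x j) := by
  simp [opMatrix]

/-- `sup_m ‖μ_m‖ < ∞`, where `μ_m [x i j] = [μ (x i j)]`. -/
def IsCompletelyBounded {K : Type*} [NormedAddCommGroup K] [InnerProductSpace ℂ K]
    {E : Type*} [NormedAddCommGroup E] [InnerProductSpace ℂ E]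
    {V : Submodule ℂ (K →L[ℂ] K)} (μ : V →ₗ[ℂ] (E →L[ℂ] E)) : Prop :=
  ∃ C : ℝ, ∀ (m : ℕ) (a : Fin m → Fin m → V),
    ‖opMatrix (fun i j => μ (a i j))‖ ≤ C * ‖opMatrix (fun i j => (a i j : K →L[ℂ] K))‖

/-- `μ_m` maps positive matrices to positive matrices for every `m`. -/
def IsCompletelyPositive {K : Type*} [NormedAddCommGroup K] [InnerProductSpace ℂ K]
    {E : Type*} [NormedAddCommGroup E] [InnerProductSpace ℂ E]
    {V : Submodule ℂ (K →L[ℂ] K)} (μ : V →ₗ[ℂ] (E →L[ℂ] E)) : Prop :=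
  ∀ (m : ℕ) (a : Fin m → Fin m → V),
    (opMatrix (fun i j => (a i j : K →L[ℂ] K))).IsPositive →
      (opMatrix (fun i j => μ (a i j))).IsPositive

/-- `T` is the bounded linear map `μ ⊗ id : V ⊗_min B(H) → B(E) ⊗_min B(H)`, that is,
`T (A ⊗ Y) = μ A ⊗ Y`. -/
def IsAmpliation {K : Type*} [NormedAddCommGroup K] [InnerProductSpace ℂ K]
    {E : Type*} [NormedAddCommGroup E] [InnerProductSpace ℂ E]
    {V : Submodule ℂ (K →L[ℂ] K)} (μ : V →ₗ[ℂ] (E →L[ℂ] E))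
    {H : Type*} [NormedAddCommGroup H] [InnerProductSpace ℂ H]
    (T : minTensor V H →L[ℂ] minTensor (⊤ : Submodule ℂ (E →L[ℂ] E)) H) : Prop :=
  ∀ (A : V) (Y : H →L[ℂ] H),
    (T ⟨opTensor (A : K →L[ℂ] K) Y, opTensor_mem_minTensor A Y⟩ :
      HTensor E H →L[ℂ] HTensor E H) = opTensor (μ A) Y

/-- There is at most one bounded map `μ ⊗ id`. -/
theorem IsAmpliation.unique {K : Type*} [NormedAddCommGroup K] [InnerProductSpace ℂ K]
    {E : Type*} [NormedAddCommGroup E] [InnerProductSpace ℂ E]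
    {V : Submodule ℂ (K →L[ℂ] K)} {μ : V →ₗ[ℂ] (E →L[ℂ] E)}
    {H : Type*} [NormedAddCommGroup H] [InnerProductSpace ℂ H]
    {T T' : minTensor V H →L[ℂ] minTensor (⊤ : Submodule ℂ (E →L[ℂ] E)) H}
    (hT : IsAmpliation μ T) (hT' : IsAmpliation μ T') : T = T' := by
  set S : Submodule ℂ (HTensor K H →L[ℂ] HTensor K H) :=
    Submodule.span ℂ {T | ∃ A ∈ V, ∃ Y : H →L[ℂ] H, T = opTensor A Y} with hS
  have key : ∀ Z (hZ : Z ∈ S), T ⟨Z, S.le_topologicalClosure hZ⟩ =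
      T' ⟨Z, S.le_topologicalClosure hZ⟩ := by
    intro Z hZ
    induction hZ using Submodule.span_induction with
    | mem x h =>
      obtain ⟨A, hA, Y, rfl⟩ := h
      exact Subtype.ext ((hT ⟨A, hA⟩ Y).trans (hT' ⟨A, hA⟩ Y).symm)
    | zero => exact (map_zero T).trans (map_zero T').symm
    | add x y hx hy h1 h2 =>
      have := congrArg₂ (· + ·) h1 h2
      simp only [← map_add] at this
      exact this
    | smul c x hx h1 =>
      have := congrArg (c • ·) h1
      simp only [← map_smul] at this
      exact this
  ext1 Z
  obtain ⟨Z, hZ⟩ := Z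
  have hd : Dense {z : minTensor V H | (z : HTensor K H →L[ℂ] HTensor K H) ∈ S} := by
    intro z
    rw [closure_subtype]
    have : (z : HTensor K H →L[ℂ] HTensor K H) ∈ closure (S : Set _) := z.2
    refine closure_mono ?_ this
    intro y hy
    exact ⟨⟨y, S.le_topologicalClosure hy⟩, hy, rfl⟩
  exact congrFun (Continuous.ext_on hd T.continuous T'.continuous
    (fun z hz => key z.1 hz)) ⟨Z, hZ⟩

open Classical in
/-- The bounded linear map `μ ⊗ id : V ⊗_min B(H) → B(E) ⊗_min B(H)` (zero if there is none). -/
def ampliation {K : Type*} [NormedAddCommGroup K] [InnerProductSpace ℂ K]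
    {E : Type*} [NormedAddCommGroup E] [InnerProductSpace ℂ E]
    {V : Submodule ℂ (K →L[ℂ] K)} (μ : V →ₗ[ℂ] (E →L[ℂ] E))
    (H : Type*) [NormedAddCommGroup H] [InnerProductSpace ℂ H] :
    minTensor V H →L[ℂ] minTensor (⊤ : Submodule ℂ (E →L[ℂ] E)) H :=
  if h : ∃ T : minTensor V H →L[ℂ] minTensor (⊤ : Submodule ℂ (E →L[ℂ] E)) H, IsAmpliation μ T
  then h.choose else 0

open Classical in
/-- The value of `μ ⊗ id` at an operator `Z ∈ V ⊗_min B(H)` (zero at other operators). -/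
def ampliationAt {K : Type*} [NormedAddCommGroup K] [InnerProductSpace ℂ K]
    {E : Type*} [NormedAddCommGroup E] [InnerProductSpace ℂ E]
    {V : Submodule ℂ (K →L[ℂ] K)} (μ : V →ₗ[ℂ] (E →L[ℂ] E))
    {H : Type*} [NormedAddCommGroup H] [InnerProductSpace ℂ H]
    (Z : HTensor K H →L[ℂ] HTensor K H) : HTensor E H →L[ℂ] HTensor E H :=
  if h : Z ∈ minTensor V H then (ampliation μ H ⟨Z, h⟩ : HTensor E H →L[ℂ] HTensor E H) else 0

/-! ### The regular polyball -/

/-- Tuples `X = (X_1, …, X_k)` with `X_i = (X_{i,1}, …, X_{i,n_i})` a tuple of operators on `H`. -/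
abbrev OpTuple {k : ℕ} (n : Fin k → ℕ) (H : Type*) [NormedAddCommGroup H]
    [InnerProductSpace ℂ H] : Type _ :=
  (i : Fin k) → Fin (n i) → (H →L[ℂ] H)

section Polyball

variable {k : ℕ} {n : Fin k → ℕ} {H : Type*} [NormedAddCommGroup H] [InnerProductSpace ℂ H]
  [CompleteSpace H]

/-- `Φ_{X_i}(Y) = ∑ j, X_{i,j} Y X_{i,j}^*`. -/
def cpMap (X : OpTuple n H) (i : Fin k) : Module.End ℂ (H →L[ℂ] H) :=
  ∑ j, LinearMap.mulLeftRight ℂ (X i j, star (X i j))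

/-- The defect mapping `Δ_X = (id - Φ_{X_1}) ∘ ⋯ ∘ (id - Φ_{X_k})`. -/
def defectMap (X : OpTuple n H) : Module.End ℂ (H →L[ℂ] H) :=
  (List.ofFn fun i => 1 - cpMap X i).prod

/-- `X` belongs to the regular polyball `B_n(H)`: entries of `X_s` and `X_t` commute for `s ≠ t`,
`‖X_{i,1} X_{i,1}^* + ⋯ + X_{i,n_i} X_{i,n_i}^*‖ < 1` for every `i`, and `Δ_X(I)` is positive and
invertible. -/
structure IsInPolyball (X : OpTuple n H) : Prop where
  commute : ∀ s t, s ≠ t → ∀ p q, Commute (X s p) (X t q)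
  norm_lt : ∀ i, ‖∑ j, X i j * star (X i j)‖ < 1
  defect_pos : (defectMap X 1).IsPositive
  defect_isUnit : IsUnit (defectMap X 1)

/-- `X_{1,α_1} ⋯ X_{k,α_k}`. -/
def wordProd (X : OpTuple n H) (α : (i : Fin k) → FreeMonoid (Fin (n i))) : H →L[ℂ] H :=
  (List.ofFn fun i => FreeMonoid.lift (X i) (α i)).prod

/-- `X_{1,α_1}^* ⋯ X_{k,α_k}^*`. -/
def wordProdStar (X : OpTuple n H) (α : (i : Fin k) → FreeMonoid (Fin (n i))) : H →L[ℂ] H :=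
  (List.ofFn fun i => star (FreeMonoid.lift (X i) (α i))).prod

/-! ### Free pluriharmonic functions -/

/-- The tuple of words `g_{j_1} ⋯ g_{j_p}` of given lengths `p = l i` with the letters
`j_q = a i q`. -/
def wordsOf {l : Fin k → ℕ} (a : (i : Fin k) → Fin (l i) → Fin (n i)) (i : Fin k) :
    FreeMonoid (Fin (n i)) :=
  FreeMonoid.ofList (List.ofFn (a i))

/-- The multi-homogeneous term of index `m ∈ ℤ^k`: the finite sum, over all `α`, `β` with
`|α_i| = m_i^-` and `|β_i| = m_i^+`, of
`A_{(α;β)} ⊗ X_{1,α_1} ⋯ X_{k,α_k} X_{1,β_1}^* ⋯ X_{k,β_k}^*`. -/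
def homogTerm {E : Type*} [NormedAddCommGroup E] [InnerProductSpace ℂ E]
    (A : ((i : Fin k) → FreeMonoid (Fin (n i))) → ((i : Fin k) → FreeMonoid (Fin (n i))) →
      (E →L[ℂ] E))
    (X : OpTuple n H) (m : Fin k → ℤ) : HTensor E H →L[ℂ] HTensor E H :=
  ∑ a : (i : Fin k) → Fin (-(m i)).toNat → Fin (n i),
    ∑ b : (i : Fin k) → Fin (m i).toNat → Fin (n i),
      opTensor (A (wordsOf a) (wordsOf b)) (wordProd X (wordsOf a) * wordProdStar X (wordsOf b))

end Polyball

/-- `F`, defined on the regular polyballs over all Hilbert spaces `H`, is free `k`-pluriharmonic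
with coefficients `A_{(α;β)} ∈ B(E)`: the series of the multi-homogeneous terms converges
(unconditionally) in the operator norm to `F(X)`, for all `X ∈ B_n(H)` and all `H`. -/
def HasPluriharmonicExpansion {k : ℕ} {n : Fin k → ℕ} {E : Type v} [NormedAddCommGroup E]
    [InnerProductSpace ℂ E]
    (A : ((i : Fin k) → FreeMonoid (Fin (n i))) → ((i : Fin k) → FreeMonoid (Fin (n i))) →
      (E →L[ℂ] E))
    (F : ∀ (H : Type u) [NormedAddCommGroup H] [InnerProductSpace ℂ H] [CompleteSpace H],
      OpTuple n H → (HTensor E H →L[ℂ] HTensor E H)) : Prop :=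
  ∀ (H : Type u) [NormedAddCommGroup H] [InnerProductSpace ℂ H] [CompleteSpace H]
    (X : OpTuple n H), IsInPolyball X → HasSum (homogTerm A X) (F H X)

/-- `F` is free `k`-pluriharmonic with operator-valued coefficients in `B(E)`. -/
def IsFreePluriharmonic {k : ℕ} {n : Fin k → ℕ} {E : Type v} [NormedAddCommGroup E]
    [InnerProductSpace ℂ E]
    (F : ∀ (H : Type u) [NormedAddCommGroup H] [InnerProductSpace ℂ H] [CompleteSpace H],
      OpTuple n H → (HTensor E H →L[ℂ] HTensor E H)) : Prop :=
  ∃ A : ((i : Fin k) → FreeMonoid (Fin (n i))) → ((i : Fin k) → FreeMonoid (Fin (n i))) →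
    (E →L[ℂ] E), HasPluriharmonicExpansion A F

/-- `F(X) ≥ 0` for all `X` in the regular polyball. -/
def IsPositiveOnPolyball {k : ℕ} {n : Fin k → ℕ} {E : Type v} [NormedAddCommGroup E]
    [InnerProductSpace ℂ E]
    (F : ∀ (H : Type u) [NormedAddCommGroup H] [InnerProductSpace ℂ H] [CompleteSpace H],
      OpTuple n H → (HTensor E H →L[ℂ] HTensor E H)) : Prop :=
  ∀ (H : Type u) [NormedAddCommGroup H] [InnerProductSpace ℂ H] [CompleteSpace H]
    (X : OpTuple n H), IsInPolyball X → (F H X).IsPositive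

/-! ### The right creation operators -/

/-- The Hilbert space `F²(H_{n_1}) ⊗ ⋯ ⊗ F²(H_{n_k})`, realized, through its orthonormal basis
`e_α = e_{α_1} ⊗ ⋯ ⊗ e_{α_k}`, as `ℓ²` of the set of `k`-tuples of words. -/
abbrev Fock {k : ℕ} (n : Fin k → ℕ) : Type :=
  lp (fun _ : ((i : Fin k) → FreeMonoid (Fin (n i))) => ℂ) 2

open Classical in
/-- The vector `e_{α_1} ⊗ ⋯ ⊗ e_{α_k}`. -/
def fockBasis {k : ℕ} (n : Fin k → ℕ) (α : (i : Fin k) → FreeMonoid (Fin (n i))) : Fock n :=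
  lp.single 2 α (1 : ℂ)

theorem orthonormal_fockBasis {k : ℕ} (n : Fin k → ℕ) : Orthonormal ℂ (fockBasis n) := by
  classical
  rw [orthonormal_iff_ite]
  intro α β
  simp only [fockBasis]
  rw [lp.inner_single_left]
  simp [lp.single_apply, Pi.single_apply]

/-- `(α_1, …, α_k) ↦ (α_1, …, α_i g_j, …, α_k)`. -/
def appendLetter {k : ℕ} {n : Fin k → ℕ} (i : Fin k) (j : Fin (n i))
    (α : (i : Fin k) → FreeMonoid (Fin (n i))) : (i : Fin k) → FreeMonoid (Fin (n i)) :=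
  Function.update α i (α i * FreeMonoid.of j)

theorem appendLetter_injective {k : ℕ} {n : Fin k → ℕ} (i : Fin k) (j : Fin (n i)) :
    Function.Injective (appendLetter (n := n) i j) := by
  intro α β h
  funext l
  have hl := congrFun h l
  by_cases hli : l = i
  · subst hli
    simp only [appendLetter, Function.update_self] at hl
    exact mul_right_cancel hl
  · simpa [appendLetter, Function.update_of_ne hli] using hl

/-- The right creation operator `R_{i,j}` on `F²(H_{n_1}) ⊗ ⋯ ⊗ F²(H_{n_k})`: the isometry with
`e_{α_1} ⊗ ⋯ ⊗ e_{α_k} ↦ e_{α_1} ⊗ ⋯ ⊗ e_{α_i g_j} ⊗ ⋯ ⊗ e_{α_k}`. -/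
def rightCreation {k : ℕ} (n : Fin k → ℕ) : OpTuple n (Fock n) := fun i j =>
  (((orthonormal_fockBasis n).comp _ (appendLetter_injective i j)).orthogonalFamily.linearIsometry
    ).toContinuousLinearMap

theorem rightCreation_fockBasis {k : ℕ} (n : Fin k → ℕ) (i : Fin k) (j : Fin (n i))
    (α : (i : Fin k) → FreeMonoid (Fin (n i))) :
    rightCreation n i j (fockBasis n α) = fockBasis n (appendLetter i j α) := by
  classical
  have := ((orthonormal_fockBasis n).comp _
    (appendLetter_injective i j)).orthogonalFamily.linearIsometry_apply_single (i := α) (1 : ℂ)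
  have h2 : fockBasis n α = lp.single 2 α (1 : ℂ) := by
    simp only [fockBasis]
  rw [h2]
  refine Eq.trans this ?_
  simp

/-- `R_n^* R_n`, the span of the operators `R_α^* R_β`. -/
def starSpan {k : ℕ} (n : Fin k → ℕ) : Submodule ℂ (Fock n →L[ℂ] Fock n) :=
  Submodule.span ℂ {T | ∃ α β : (i : Fin k) → FreeMonoid (Fin (n i)),
    T = star (wordProd (rightCreation n) α) * wordProd (rightCreation n) β}

/-! ### The Poisson kernel, the operator `C_X`, and the transforms -/

/-- The coefficients
`R_{1,α̃_1}^* ⋯ R_{k,α̃_k}^* R_{1,β̃_1} ⋯ R_{k,β̃_k}` of the Poisson kernel, where `α̃` is the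
reverse of the word `α`. -/
def poissonCoeff {k : ℕ} (n : Fin k → ℕ) (α β : (i : Fin k) → FreeMonoid (Fin (n i))) :
    Fock n →L[ℂ] Fock n :=
  wordProdStar (rightCreation n) (fun i => (α i).reverse) *
    wordProd (rightCreation n) (fun i => (β i).reverse)

/-- The free pluriharmonic Poisson kernel `P(R, X)`: the sum of the operator norm convergent
series with the coefficients `poissonCoeff`. -/
def poissonKernel {k : ℕ} {n : Fin k → ℕ} (H : Type*) [NormedAddCommGroup H]
    [InnerProductSpace ℂ H] [CompleteSpace H] (X : OpTuple n H) :
    HTensor (Fock n) H →L[ℂ] HTensor (Fock n) H :=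
  ∑' m : Fin k → ℤ, homogTerm (poissonCoeff n) X m

/-- `I - R_{i,1} ⊗ X_{i,1}^* - ⋯ - R_{i,n_i} ⊗ X_{i,n_i}^*`. -/
def resolventOp {k : ℕ} {n : Fin k → ℕ} {H : Type*} [NormedAddCommGroup H]
    [InnerProductSpace ℂ H] [CompleteSpace H] (X : OpTuple n H) (i : Fin k) :
    HTensor (Fock n) H →L[ℂ] HTensor (Fock n) H :=
  1 - ∑ j, opTensor (rightCreation n i j) (star (X i j))

/-- `C_X = (I ⊗ Δ_X(I)^{1/2}) ∏_{i=1}^k (I - ∑ j, R_{i,j} ⊗ X_{i,j}^*)^{-1}`. -/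
def cOp {k : ℕ} {n : Fin k → ℕ} {H : Type*} [NormedAddCommGroup H]
    [InnerProductSpace ℂ H] [CompleteSpace H] (X : OpTuple n H) :
    HTensor (Fock n) H →L[ℂ] HTensor (Fock n) H :=
  opTensor 1 (CFC.sqrt (defectMap X 1)) *
    (List.ofFn fun i => Ring.inverse (resolventOp X i)).prod

/-- The Poisson transform `(P μ)(X) = (μ ⊗ id)[P(R, X)]`. -/
def poissonTransform {k : ℕ} {n : Fin k → ℕ} {E : Type*} [NormedAddCommGroup E]
    [InnerProductSpace ℂ E] (μ : starSpan n →ₗ[ℂ] (E →L[ℂ] E))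
    (H : Type*) [NormedAddCommGroup H] [InnerProductSpace ℂ H] [CompleteSpace H]
    (X : OpTuple n H) : HTensor E H →L[ℂ] HTensor E H :=
  ampliationAt μ (poissonKernel H X)

/-- The Berezin transform `B_μ(A, X) = (μ ⊗ id)[C_X^* (A ⊗ I) C_X]` of a linear map `μ` on a space
`V` of operators (it is used where `C_X^* (A ⊗ I) C_X ∈ V ⊗_min B(H)`). -/
def berezinTransform {k : ℕ} {n : Fin k → ℕ} {E : Type*} [NormedAddCommGroup E]
    [InnerProductSpace ℂ E] {V : Submodule ℂ (Fock n →L[ℂ] Fock n)}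
    (μ : V →ₗ[ℂ] (E →L[ℂ] E)) (A : Fock n →L[ℂ] Fock n)
    (H : Type*) [NormedAddCommGroup H] [InnerProductSpace ℂ H] [CompleteSpace H]
    (X : OpTuple n H) : HTensor E H →L[ℂ] HTensor E H :=
  ampliationAt μ (star (cOp X) * opTensor A 1 * cOp X)

end

end Polyball

/-!
Write `T_i = ∑ j, R_{i,j} ⊗ X_{i,j}^*`.  The `R_{i,j}` are isometries with orthogonal ranges, so
`T_i^* (I ⊗ Y) T_i = I ⊗ Φ_{X_i}(Y)`.  For `Y = I` this gives
`‖T_i‖² = ‖∑ j, X_{i,j} X_{i,j}^*‖ < 1`, hence `I - T_i` is invertible; applying the identity for each `i` gives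
`(id - Θ_1) ∘ ⋯ ∘ (id - Θ_k) (I) = I ⊗ Δ_X(I)` for `Θ_i(Z) = T_i^* Z T_i`.  The operators
`T_1, …, T_k` commute, and expanding powers of `T_i` along words shows that the term of index
`m ∈ ℤ^k` of the Poisson series is `∏ (T_i^*)^{m_i^-} ∏ T_i^{m_i^+}` (`homogTerm_poissonCoeff`).

Left multiplications `L_i` by `T_i^*` and right multiplications `R_i` by `T_i` all commute, although
`T_i^*` and `T_j` need not.  In the Banach algebra of bounded maps on operators, the series is
therefore the product over `i` of the one-variable series
`∑ m, L_i^{m^-} R_i^{m^+} = (1 - L_i)⁻¹ (1 - R_i)⁻¹ (1 - L_i R_i)`, each of which converges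
absolutely (`exists_hasSum_poisson`).  Evaluation at `I` gives
`P(R, X) = ∏ (I - T_i^*)⁻¹ (I ⊗ Δ_X(I)) ∏ (I - T_i)⁻¹ = C_X^* C_X`, hence convergence, the
factorization and positivity (`isUnit_resolventOp_and_hasSum`).

For the ampliation of a completely bounded `μ`, two vectors of the algebraic tensor product `E ⊗ H`
lie in `E ⊗ span(e_1, …, e_m)` for an orthonormal family `e`.  There `∑ μ(A) ⊗ Y` acts as the
operator matrix with entries `μ(a_{pq})`, where `[a_{pq}]` is the compression of `∑ A ⊗ Y` along the
same family (`inner_frameVec_algAmpliation`).  Complete boundedness bounds `μ ⊗ id` on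
the algebraic tensor product `V ⊗ B(H)`, and it extends to the closure (`exists_isAmpliation`).
Complete positivity gives positivity on the algebraic tensor product, and it passes to the closure
because the span of the `R_α^* R_β` is an operator system, so that positive elements of the closure
are limits of positive elements of the span (`IsAmpliation.isPositive`).  Applying the bounded map
`μ ⊗ id` term by term to the Poisson series gives the expansion of the Poisson transform, with
coefficients `μ` of those of the kernel.
-/

namespace Polyball

/-! ### Tensor products of operators -/

section OpTensor

variable {E H : Type*} [NormedAddCommGroup E] [InnerProductSpace ℂ E]
  [NormedAddCommGroup H] [InnerProductSpace ℂ H]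

theorem HTensor.clm_ext {S T : HTensor E H →L[ℂ] HTensor E H}
    (h : ∀ (x : E) (y : H), S ((x ⊗ₜ[ℂ] y : E ⊗[ℂ] H) : HTensor E H) =
      T ((x ⊗ₜ[ℂ] y : E ⊗[ℂ] H) : HTensor E H)) : S = T := by
  ext z
  induction z using UniformSpace.Completion.induction_on with
  | hp => exact isClosed_eq S.continuous T.continuous
  | ih z =>
    induction z using TensorProduct.induction_on with
    | zero => rw [UniformSpace.Completion.coe_zero, map_zero, map_zero]
    | tmul x y => exact h x y
    | add x y hx hy => simp only [UniformSpace.Completion.coe_add, map_add, hx, hy]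

theorem opTensor_add_left (A B : E →L[ℂ] E) (Y : H →L[ℂ] H) :
    opTensor (A + B) Y = opTensor A Y + opTensor B Y :=
  HTensor.clm_ext fun x y => by
    simp [opTensor_tmul, TensorProduct.add_tmul, UniformSpace.Completion.coe_add]

theorem opTensor_add_right (A : E →L[ℂ] E) (Y Z : H →L[ℂ] H) :
    opTensor A (Y + Z) = opTensor A Y + opTensor A Z :=
  HTensor.clm_ext fun x y => by
    simp [opTensor_tmul, TensorProduct.tmul_add, UniformSpace.Completion.coe_add]

theorem opTensor_smul_left (c : ℂ) (A : E →L[ℂ] E) (Y : H →L[ℂ] H) :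
    opTensor (c • A) Y = c • opTensor A Y :=
  HTensor.clm_ext fun x y => by
    simp only [opTensor_tmul, smul_apply, ← TensorProduct.smul_tmul',
      UniformSpace.Completion.coe_smul]

theorem opTensor_smul_right (c : ℂ) (A : E →L[ℂ] E) (Y : H →L[ℂ] H) :
    opTensor A (c • Y) = c • opTensor A Y :=
  HTensor.clm_ext fun x y => by
    simp [opTensor_tmul, UniformSpace.Completion.coe_smul]

variable (E H) in
/-- The bilinear map `(A, Y) ↦ A ⊗ Y`. -/
noncomputable def opTensorₗ : (E →L[ℂ] E) →ₗ[ℂ] (H →L[ℂ] H) →ₗ[ℂ]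
    (HTensor E H →L[ℂ] HTensor E H) :=
  LinearMap.mk₂ ℂ opTensor opTensor_add_left opTensor_smul_left opTensor_add_right
    opTensor_smul_right

@[simp]
theorem opTensorₗ_apply (A : E →L[ℂ] E) (Y : H →L[ℂ] H) :
    opTensorₗ E H A Y = opTensor A Y := rfl

theorem opTensor_sum_right {ι : Type*} (s : Finset ι) (A : E →L[ℂ] E) (Y : ι → H →L[ℂ] H) :
    opTensor A (∑ i ∈ s, Y i) = ∑ i ∈ s, opTensor A (Y i) :=
  map_sum (opTensorₗ E H A) Y s

@[simp]
theorem opTensor_one : opTensor (1 : E →L[ℂ] E) (1 : H →L[ℂ] H) = 1 :=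
  HTensor.clm_ext fun x y => by simp [opTensor_tmul]

@[simp]
theorem opTensor_zero_left (Y : H →L[ℂ] H) : opTensor (0 : E →L[ℂ] E) Y = 0 := by
  simp [← opTensorₗ_apply]

theorem opTensor_mul (A B : E →L[ℂ] E) (Y Z : H →L[ℂ] H) :
    opTensor A Y * opTensor B Z = opTensor (A * B) (Y * Z) :=
  HTensor.clm_ext fun x y => by simp [opTensor_tmul]

theorem opTensor_listProd {k : ℕ} (A : Fin k → E →L[ℂ] E) (Y : Fin k → H →L[ℂ] H) :
    (List.ofFn fun i => opTensor (A i) (Y i)).prod =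
      opTensor (List.ofFn A).prod (List.ofFn Y).prod := by
  induction k with
  | zero => simp
  | succ k ih => simp [List.ofFn_succ, ih, opTensor_mul]

theorem norm_opTensor_le (A : E →L[ℂ] E) (Y : H →L[ℂ] H) :
    ‖opTensor A Y‖ ≤ ‖A‖ * ‖Y‖ := by
  refine ContinuousLinearMap.opNorm_le_bound _ (by positivity) fun z => ?_
  induction z using UniformSpace.Completion.induction_on with
  | hp => exact isClosed_le (by fun_prop) (by fun_prop)
  | ih z =>
    rw [opTensor, ContinuousLinearMap.completion_apply_coe, UniformSpace.Completion.norm_coe,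
      UniformSpace.Completion.norm_coe]
    exact ((TensorProduct.mapL A Y).le_opNorm z).trans
      (mul_le_mul_of_nonneg_right (TensorProduct.norm_mapL_le A Y) (norm_nonneg z))

theorem HTensor.inner_tmul (x x' : E) (y y' : H) :
    inner ℂ ((x ⊗ₜ[ℂ] y : E ⊗[ℂ] H) : HTensor E H) ((x' ⊗ₜ[ℂ] y' : E ⊗[ℂ] H) : HTensor E H) =
      inner ℂ x x' * inner ℂ y y' := by
  rw [UniformSpace.Completion.inner_coe, TensorProduct.inner_tmul]

theorem star_opTensor [CompleteSpace E] [CompleteSpace H] (A : E →L[ℂ] E) (Y : H →L[ℂ] H) :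
    star (opTensor A Y) = opTensor (star A) (star Y) := by
  have key : ∀ u v : HTensor E H,
      inner ℂ (opTensor (star A) (star Y) u) v = inner ℂ u (opTensor A Y v) := by
    intro u v
    induction u, v using UniformSpace.Completion.induction_on₂ with
    | hp => exact isClosed_eq (by fun_prop) (by fun_prop)
    | ih u v =>
      induction u using TensorProduct.induction_on with
      | zero => simp only [UniformSpace.Completion.coe_zero, map_zero, inner_zero_left]
      | add u u' hu hu' =>
        simp only [UniformSpace.Completion.coe_add, map_add, inner_add_left, hu, hu']
      | tmul x y =>
        induction v using TensorProduct.induction_on with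
        | zero => simp only [UniformSpace.Completion.coe_zero, map_zero, inner_zero_right]
        | add u u' hu hu' =>
          simp only [UniformSpace.Completion.coe_add, map_add, inner_add_right, hu, hu']
        | tmul x' y' =>
          simp only [opTensor_tmul, HTensor.inner_tmul, ContinuousLinearMap.star_eq_adjoint,
            ContinuousLinearMap.adjoint_inner_left]
  exact ((ContinuousLinearMap.eq_adjoint_iff _ _).2 key).symm

end OpTensor

/-! ### Products over a list of indices -/

section ListProd

/-- Distributivity for an ordered product of sums. -/
theorem prod_ofFn_sum {R : Type*} [Semiring R] {k : ℕ} {ι : Fin k → Type*}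
    [∀ i, Fintype (ι i)] (f : ∀ i, ι i → R) :
    (List.ofFn fun i => ∑ c, f i c).prod =
      ∑ b : ∀ i, ι i, (List.ofFn fun i => f i (b i)).prod := by
  induction k with
  | zero => simp
  | succ k ih =>
    rw [← (Fin.consEquiv ι).sum_comp, Fintype.sum_prod_type, List.ofFn_succ, List.prod_cons, ih,
      Finset.sum_mul_sum]
    simp [List.ofFn_succ, Fin.consEquiv]

theorem commute_prod_ofFn {M : Type*} [Monoid M] {k : ℕ} {a : M} {g : Fin k → M}
    (h : ∀ i, Commute a (g i)) : Commute a (List.ofFn g).prod :=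
  Commute.list_prod_right _ _ fun x hx => by
    obtain ⟨i, rfl⟩ := (List.mem_ofFn' g x).1 hx
    exact h i

theorem prod_ofFn_mul {M : Type*} [Monoid M] {k : ℕ} {f g : Fin k → M}
    (h : ∀ i j, i ≠ j → Commute (g i) (f j)) :
    (List.ofFn fun i => f i * g i).prod = (List.ofFn f).prod * (List.ofFn g).prod := by
  induction k with
  | zero => simp
  | succ k ih =>
    have hc : Commute (g 0) (List.ofFn fun i : Fin k => f i.succ).prod :=
      commute_prod_ofFn fun i => h _ _ (Fin.succ_ne_zero i).symm
    rw [List.ofFn_succ, List.ofFn_succ (f := f), List.ofFn_succ (f := g), List.prod_cons,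
      List.prod_cons, List.prod_cons, ih fun i j hij => h _ _ (by simpa using hij)]
    simp only [mul_assoc]
    rw [← mul_assoc (g 0), hc.eq, mul_assoc]

theorem star_prod_ofFn {R : Type*} [Monoid R] [StarMul R] {k : ℕ} {f : Fin k → R}
    (h : ∀ i j, i ≠ j → Commute (f i) (f j)) :
    star (List.ofFn f).prod = (List.ofFn fun i => star (f i)).prod := by
  induction k with
  | zero => simp
  | succ k ih =>
    have hc : Commute (f 0) (List.ofFn fun i : Fin k => f i.succ).prod :=
      commute_prod_ofFn fun i => h _ _ (Fin.succ_ne_zero i).symm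
    rw [List.ofFn_succ, List.ofFn_succ (f := fun i => star (f i)), List.prod_cons,
      List.prod_cons, hc.eq, star_mul, ih fun i j hij => h _ _ (by simpa using hij)]

/-- A product of absolutely convergent series in a Banach algebra, in a fixed order, is the sum of
the absolutely convergent multiple series. -/
theorem hasSum_prod_ofFn {R ι : Type*} [NormedRing R] [CompleteSpace R] {k : ℕ}
    (f : Fin k → ι → R) (hf : ∀ i, Summable fun c => ‖f i c‖) :
    (Summable fun m : Fin k → ι => ‖(List.ofFn fun i => f i (m i)).prod‖) ∧
      HasSum (fun m : Fin k → ι => (List.ofFn fun i => f i (m i)).prod)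
        (List.ofFn fun i => ∑' c, f i c).prod := by
  induction k with
  | zero =>
    refine ⟨(hasSum_fintype _).summable, ?_⟩
    convert hasSum_fintype (fun m : Fin 0 → ι => (List.ofFn fun i => f i (m i)).prod)
    simp
  | succ k ih =>
    obtain ⟨h1, h2⟩ := ih (fun i => f i.succ) fun i => hf i.succ
    have hs := (hf 0).mul_norm h1
    have hp := (Summable.of_norm hs).hasSum
    rw [← tsum_mul_tsum_of_summable_norm (hf 0) h1, h2.tsum_eq] at hp
    have e : (fun m : Fin (k + 1) → ι => (List.ofFn fun i => f i (m i)).prod) ∘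
        (Fin.consEquiv fun _ => ι) =
          fun a => f 0 a.1 * (List.ofFn fun i => f i.succ (a.2 i)).prod := by
      funext x
      simp [List.ofFn_succ, Fin.consEquiv]
    constructor
    · rw [← (Fin.consEquiv fun _ => ι).summable_iff]
      convert hs using 2 with x
      exact congrArg norm (congrFun e x)
    · rw [← (Fin.consEquiv fun _ => ι).hasSum_iff, e, List.ofFn_succ, List.prod_cons]
      exact hp

end ListProd

/-! ### The ampliation of a completely bounded map -/

section Frame

open scoped ComplexOrder

variable {E H : Type*} [NormedAddCommGroup E] [InnerProductSpace ℂ E]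
  [NormedAddCommGroup H] [InnerProductSpace ℂ H]

/-- The vector `∑ j, x j ⊗ e j`. -/
noncomputable def frameVec {m : ℕ} (e : Fin m → H) (x : PiLp 2 fun _ : Fin m => E) :
    HTensor E H :=
  ∑ j, ((x j ⊗ₜ[ℂ] e j : E ⊗[ℂ] H) : HTensor E H)

theorem norm_frameVec {m : ℕ} {e : Fin m → H} (he : Orthonormal ℂ e)
    (x : PiLp 2 fun _ : Fin m => E) : ‖frameVec e x‖ = ‖x‖ := by
  have h : inner ℂ (frameVec e x) (frameVec e x) = inner ℂ x x := by
    simp only [frameVec, sum_inner, inner_sum, HTensor.inner_tmul, orthonormal_iff_ite.1 he,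
      PiLp.inner_apply]
    simp
  rw [inner_self_eq_norm_sq_to_K, inner_self_eq_norm_sq_to_K] at h
  exact (sq_eq_sq₀ (norm_nonneg _) (norm_nonneg _)).1 (by exact_mod_cast h)

/-- A vector of the algebraic tensor product can be expanded along any finite family whose span is
large enough. -/
theorem exists_frame_of_span (ξ : E ⊗[ℂ] H) :
    ∃ F : Submodule ℂ H, FiniteDimensional ℂ F ∧ ∀ (m : ℕ) (e : Fin m → H),
      F ≤ Submodule.span ℂ (Set.range e) →
        ∃ x : PiLp 2 fun _ : Fin m => E, frameVec e x = (ξ : HTensor E H) := by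
  induction ξ using TensorProduct.induction_on with
  | zero => exact ⟨⊥, inferInstance, fun m e _ => ⟨0, by
    simp only [frameVec, PiLp.zero_apply, TensorProduct.zero_tmul, UniformSpace.Completion.coe_zero,
      Finset.sum_const_zero]⟩⟩
  | tmul x h =>
    refine ⟨Submodule.span ℂ {h}, inferInstance, fun m e hF => ?_⟩
    obtain ⟨c, hc⟩ := (Submodule.mem_span_range_iff_exists_fun ℂ).1
      (hF (Submodule.mem_span_singleton_self h))
    refine ⟨WithLp.toLp 2 fun i => c i • x, ?_⟩
    have := congrArg (fun z => ((x ⊗ₜ[ℂ] z : E ⊗[ℂ] H) : HTensor E H)) hc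
    rw [← this, TensorProduct.tmul_sum]
    simp only [frameVec, TensorProduct.smul_tmul]
    exact (map_sum (UniformSpace.Completion.toComplL (𝕜 := ℂ) (E := E ⊗[ℂ] H)) _ _).symm
  | add ξ η hξ hη =>
    obtain ⟨F, hF, h⟩ := hξ
    obtain ⟨F', hF', h'⟩ := hη
    refine ⟨F ⊔ F', inferInstance, fun m e hle => ?_⟩
    obtain ⟨x, hx⟩ := h m e (le_sup_left.trans hle)
    obtain ⟨x', hx'⟩ := h' m e (le_sup_right.trans hle)
    refine ⟨x + x', ?_⟩
    rw [UniformSpace.Completion.coe_add, ← hx, ← hx']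
    simp [frameVec, TensorProduct.add_tmul, UniformSpace.Completion.coe_add,
      Finset.sum_add_distrib]

/-- Two vectors of the algebraic tensor product can be expanded along one finite orthonormal
family in the second factor. -/
theorem exists_orthonormal_frame (ξ η : E ⊗[ℂ] H) :
    ∃ (m : ℕ) (e : Fin m → H), Orthonormal ℂ e ∧
      (∃ x : PiLp 2 fun _ : Fin m => E, frameVec e x = (ξ : HTensor E H)) ∧
      ∃ y : PiLp 2 fun _ : Fin m => E, frameVec e y = (η : HTensor E H) := by
  obtain ⟨F, hF, h⟩ := exists_frame_of_span ξ
  obtain ⟨F', hF', h'⟩ := exists_frame_of_span η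
  let b := stdOrthonormalBasis ℂ ↥(F ⊔ F')
  have hb : F ⊔ F' ≤ Submodule.span ℂ (Set.range fun i => (b i : H)) := by
    have h1 : (Set.range fun i => (b i : H)) = (F ⊔ F').subtype '' Set.range b := by
      rw [← Set.range_comp]; rfl
    have h2 : Submodule.span ℂ (Set.range b) = ⊤ := by
      rw [← OrthonormalBasis.coe_toBasis]; exact b.toBasis.span_eq
    rw [h1, Submodule.span_image, h2, Submodule.map_subtype_top]
  exact ⟨_, fun i => (b i : H), b.orthonormal.comp_linearIsometry (F ⊔ F').subtypeₗᵢ,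
    h _ _ (le_sup_left.trans hb), h' _ _ (le_sup_right.trans hb)⟩

theorem opNorm_le_of_forall_inner {G : Type*} [NormedAddCommGroup G] [InnerProductSpace ℂ G]
    {T : G →L[ℂ] G} {c : ℝ} (hc : 0 ≤ c)
    (h : ∀ x y, ‖inner ℂ y (T x)‖ ≤ c * ‖x‖ * ‖y‖) : ‖T‖ ≤ c := by
  refine T.opNorm_le_bound hc fun x => ?_
  have h1 := h x (T x)
  rw [← inner_self_ofReal_norm, RCLike.norm_ofReal, abs_norm,
    ← inner_self_re_eq_norm, inner_self_eq_norm_mul_norm] at h1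
  rcases (norm_nonneg (T x)).eq_or_lt with h0 | h0
  · rw [← h0]; positivity
  · exact le_of_mul_le_mul_right h1 h0

/-- The norm of an operator on the Hilbert tensor product is determined on the algebraic one. -/
theorem opNorm_le_of_forall_inner_coe {T : HTensor E H →L[ℂ] HTensor E H} {c : ℝ} (hc : 0 ≤ c)
    (h : ∀ ξ η : E ⊗[ℂ] H, ‖inner ℂ (η : HTensor E H) (T (ξ : HTensor E H))‖ ≤
      c * ‖(ξ : HTensor E H)‖ * ‖(η : HTensor E H)‖) : ‖T‖ ≤ c := by
  refine opNorm_le_of_forall_inner hc fun x y => ?_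
  induction x, y using UniformSpace.Completion.induction_on₂ with
  | hp => exact isClosed_le (by fun_prop) (by fun_prop)
  | ih ξ η => exact h ξ η

theorem isPositive_iff_inner_nonneg {G : Type*} [NormedAddCommGroup G] [InnerProductSpace ℂ G]
    {T : G →L[ℂ] G} : T.IsPositive ↔ ∀ x, 0 ≤ inner ℂ x (T x) := by
  refine ⟨fun h x => h.inner_nonneg_right x, fun h => ?_⟩
  rw [ContinuousLinearMap.isPositive_iff_complex]
  intro x
  obtain ⟨h1, h2⟩ := Complex.nonneg_iff.1 (h x)
  have h3 : inner ℂ (T x) x = inner ℂ x (T x) := by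
    rw [← inner_conj_symm]
    exact Complex.conj_eq_iff_im.2 h2.symm
  rw [h3]
  exact ⟨Complex.ext rfl h2, h1⟩

theorem isPositive_of_inner_coe_nonneg {T : HTensor E H →L[ℂ] HTensor E H}
    (h : ∀ ξ : E ⊗[ℂ] H, 0 ≤ inner ℂ (ξ : HTensor E H) (T (ξ : HTensor E H))) :
    T.IsPositive := by
  refine isPositive_iff_inner_nonneg.2 fun x => ?_
  induction x using UniformSpace.Completion.induction_on with
  | hp => exact isClosed_le (by fun_prop) (by fun_prop)
  | ih ξ => exact h ξ

end Frame

section Ampliation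

open scoped ComplexOrder

variable {K E H : Type*} [NormedAddCommGroup K] [InnerProductSpace ℂ K]
  [NormedAddCommGroup E] [InnerProductSpace ℂ E] [NormedAddCommGroup H] [InnerProductSpace ℂ H]
  {V : Submodule ℂ (K →L[ℂ] K)}

/-- The map `∑ A ⊗ Y ↦ ∑ μ A ⊗ Y` on the algebraic tensor product `V ⊗ B(H)`.  For the inclusion
`μ = V.subtype` it realizes `V ⊗ B(H)` as operators. -/
noncomputable def algAmpliation (μ : V →ₗ[ℂ] (E →L[ℂ] E)) (H : Type*) [NormedAddCommGroup H]
    [InnerProductSpace ℂ H] :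
    (V ⊗[ℂ] (H →L[ℂ] H)) →ₗ[ℂ] (HTensor E H →L[ℂ] HTensor E H) :=
  TensorProduct.lift (opTensorₗ E H ∘ₗ μ)

@[simp]
theorem algAmpliation_tmul (μ : V →ₗ[ℂ] (E →L[ℂ] E)) (A : V) (Y : H →L[ℂ] H) :
    algAmpliation μ H (A ⊗ₜ Y) = opTensor (μ A) Y := by
  simp [algAmpliation]

/-- The slice map `A ⊗ Y ↦ ⟪u, Y v⟫ A`. -/
noncomputable def slice (V : Submodule ℂ (K →L[ℂ] K)) (u v : H) :
    (V ⊗[ℂ] (H →L[ℂ] H)) →ₗ[ℂ] V :=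
  TensorProduct.lift <| LinearMap.mk₂ ℂ (fun A Y => (inner ℂ u (Y v) : ℂ) • A)
    (fun _ _ _ => smul_add _ _ _) (fun _ _ _ => smul_comm _ _ _)
    (fun _ _ _ => by simp [add_smul]) (fun _ _ _ => by simp [mul_smul])

@[simp]
theorem slice_tmul (u v : H) (A : V) (Y : H →L[ℂ] H) :
    slice V u v (A ⊗ₜ Y) = (inner ℂ u (Y v) : ℂ) • A := by
  simp [slice]

theorem opMatrix_add {m : ℕ} (a b : Fin m → Fin m → (E →L[ℂ] E)) :
    opMatrix (fun i j => a i j + b i j) = opMatrix a + opMatrix b := by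
  ext x i
  simp [opMatrix_apply, Finset.sum_add_distrib]

/-- Along a finite family `e` in `H`, the operator `(μ ⊗ id) t` is compressed to the operator
matrix with entries `μ (slice t)`. -/
theorem inner_frameVec_algAmpliation (μ : V →ₗ[ℂ] (E →L[ℂ] E)) (t : V ⊗[ℂ] (H →L[ℂ] H)) {m : ℕ}
    (e : Fin m → H) (x y : PiLp 2 fun _ : Fin m => E) :
    inner ℂ (frameVec e y) (algAmpliation μ H t (frameVec e x)) =
      inner ℂ y (opMatrix (fun i j => μ (slice V (e i) (e j) t)) x) := by
  induction t using TensorProduct.induction_on with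
  | zero => simp [PiLp.inner_apply, opMatrix_apply]
  | add s t hs ht =>
    simp only [map_add, add_apply, inner_add_right, opMatrix_add, hs, ht]
  | tmul A Y =>
    simp only [algAmpliation_tmul, slice_tmul, PiLp.inner_apply, opMatrix_apply, frameVec,
      map_sum, opTensor_tmul, sum_inner, inner_sum, HTensor.inner_tmul, map_smul,
      smul_apply, inner_smul_right]
    rw [Finset.sum_comm]
    exact Finset.sum_congr rfl fun i _ => Finset.sum_congr rfl fun j _ => mul_comm _ _

/-- The `cb`-bound of `μ` bounds `μ ⊗ id` on the algebraic tensor product, since compression along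
an orthonormal family does not increase the norm. -/
theorem norm_algAmpliation_le {μ : V →ₗ[ℂ] (E →L[ℂ] E)} {C : ℝ} (hC : 0 ≤ C)
    (hμ : ∀ (m : ℕ) (a : Fin m → Fin m → V),
      ‖opMatrix (fun i j => μ (a i j))‖ ≤ C * ‖opMatrix (fun i j => (a i j : K →L[ℂ] K))‖)
    (t : V ⊗[ℂ] (H →L[ℂ] H)) :
    ‖algAmpliation μ H t‖ ≤ C * ‖algAmpliation V.subtype H t‖ := by
  refine opNorm_le_of_forall_inner_coe (by positivity) fun ξ η => ?_
  obtain ⟨m, e, he, ⟨x, hx⟩, y, hy⟩ := exists_orthonormal_frame ξ η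
  have hm : ‖opMatrix (fun i j => (slice V (e i) (e j) t : K →L[ℂ] K))‖ ≤
      ‖algAmpliation V.subtype H t‖ := by
    refine opNorm_le_of_forall_inner (norm_nonneg (algAmpliation V.subtype H t)) fun x y => ?_
    have := inner_frameVec_algAmpliation V.subtype t e x y
    simp only [Submodule.subtype_apply] at this
    rw [← this, ← norm_frameVec he x, ← norm_frameVec he y]
    refine (norm_inner_le_norm _ _).trans ?_
    rw [mul_comm]
    gcongr
    exact ContinuousLinearMap.le_opNorm _ _
  rw [← hx, ← hy, inner_frameVec_algAmpliation, norm_frameVec he, norm_frameVec he]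
  refine (norm_inner_le_norm _ _).trans ?_
  rw [mul_comm]
  gcongr
  refine (ContinuousLinearMap.le_opNorm _ _).trans ?_
  gcongr
  exact (hμ m _).trans (by gcongr)

theorem algAmpliation_isPositive {μ : V →ₗ[ℂ] (E →L[ℂ] E)} (hμ : IsCompletelyPositive μ)
    {t : V ⊗[ℂ] (H →L[ℂ] H)} (ht : (algAmpliation V.subtype H t).IsPositive) :
    (algAmpliation μ H t).IsPositive := by
  refine isPositive_of_inner_coe_nonneg fun ξ => ?_
  obtain ⟨m, e, -, ⟨x, hx⟩, -⟩ := exists_orthonormal_frame ξ ξ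
  rw [← hx, inner_frameVec_algAmpliation]
  refine (hμ m _ (isPositive_iff_inner_nonneg.2 fun y => ?_)).inner_nonneg_right x
  exact (ht.inner_nonneg_right (frameVec e y)).trans_eq
    (inner_frameVec_algAmpliation V.subtype t e y y)

theorem range_algAmpliation_subtype :
    LinearMap.range (algAmpliation V.subtype H) =
      Submodule.span ℂ {T | ∃ A ∈ V, ∃ Y : H →L[ℂ] H, T = opTensor A Y} := by
  apply le_antisymm
  · rintro _ ⟨t, rfl⟩
    induction t using TensorProduct.induction_on with
    | zero => simp
    | add s t hs ht => rw [map_add]; exact add_mem hs ht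
    | tmul A Y => exact Submodule.subset_span ⟨A, A.2, Y, by simp⟩
  · rw [Submodule.span_le]
    rintro _ ⟨A, hA, Y, rfl⟩
    exact ⟨(⟨A, hA⟩ : V) ⊗ₜ Y, by simp⟩

theorem algAmpliation_mem_minTensor (μ : V →ₗ[ℂ] (E →L[ℂ] E)) {W : Submodule ℂ (E →L[ℂ] E)}
    (hW : ∀ A, μ A ∈ W) (t : V ⊗[ℂ] (H →L[ℂ] H)) : algAmpliation μ H t ∈ minTensor W H := by
  induction t using TensorProduct.induction_on with
  | zero => simp
  | add s t hs ht => rw [map_add]; exact add_mem hs ht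
  | tmul A Y => rw [algAmpliation_tmul]; exact opTensor_mem_minTensor ⟨_, hW A⟩ Y

/-- If `‖ψ t‖ ≤ C ‖φ t‖` then `φ t ↦ ψ t` is well defined and extends to the closure of the range
of `φ`. -/
theorem exists_extension_topologicalClosure {M B₁ B₂ : Type*} [AddCommGroup M] [Module ℂ M]
    [NormedAddCommGroup B₁] [NormedSpace ℂ B₁] [NormedAddCommGroup B₂] [NormedSpace ℂ B₂]
    [CompleteSpace B₂] (φ : M →ₗ[ℂ] B₁) (ψ : M →ₗ[ℂ] B₂) {C : ℝ} (h : ∀ t, ‖ψ t‖ ≤ C * ‖φ t‖)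
    (W₁ : Submodule ℂ B₁) (hW₁ : W₁ = (LinearMap.range φ).topologicalClosure)
    (W₂ : Submodule ℂ B₂) (hW₂ : IsClosed (W₂ : Set B₂)) (hψ : ∀ t, ψ t ∈ W₂) :
    ∃ T : W₁ →L[ℂ] W₂, ∀ t (ht : φ t ∈ W₁), (T ⟨φ t, ht⟩ : B₂) = ψ t := by
  have hφ : ∀ t, φ t ∈ W₁ := fun t => by
    rw [hW₁]; exact Submodule.le_topologicalClosure _ ⟨t, rfl⟩
  have : CompleteSpace W₂ := hW₂.completeSpace_coe
  have hd : DenseRange (φ.codRestrict W₁ hφ) := by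
    intro z
    rw [closure_subtype]
    have hz : (z : B₁) ∈ (LinearMap.range φ).topologicalClosure := hW₁ ▸ z.2
    refine closure_mono ?_ hz
    rintro _ ⟨t, rfl⟩
    exact ⟨_, ⟨t, rfl⟩, rfl⟩
  refine ⟨(ψ.codRestrict W₂ hψ).extendOfNorm (φ.codRestrict W₁ hφ), fun t ht => ?_⟩
  exact congrArg Subtype.val
    (LinearMap.extendOfNorm_eq (f := ψ.codRestrict W₂ hψ) hd ⟨C, h⟩ t)

/-- `exists_extension_topologicalClosure` for spaces of operators, with the vector space structure
of operators rather than the one derived from the operator norm. -/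
theorem exists_extension_topologicalClosure_clm {M G₁ G₂ : Type*} [AddCommMonoid M] [Module ℂ M]
    [NormedAddCommGroup G₁] [InnerProductSpace ℂ G₁] [NormedAddCommGroup G₂]
    [InnerProductSpace ℂ G₂] [CompleteSpace G₂] (φ : M →ₗ[ℂ] (G₁ →L[ℂ] G₁))
    (ψ : M →ₗ[ℂ] (G₂ →L[ℂ] G₂)) {C : ℝ} (h : ∀ t, ‖ψ t‖ ≤ C * ‖φ t‖)
    (W₁ : Submodule ℂ (G₁ →L[ℂ] G₁)) (hW₁ : W₁ = (LinearMap.range φ).topologicalClosure)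
    (W₂ : Submodule ℂ (G₂ →L[ℂ] G₂)) (hW₂ : IsClosed (W₂ : Set (G₂ →L[ℂ] G₂)))
    (hψ : ∀ t, ψ t ∈ W₂) :
    ∃ T : W₁ →L[ℂ] W₂, ∀ t (ht : φ t ∈ W₁), (T ⟨φ t, ht⟩ : G₂ →L[ℂ] G₂) = ψ t :=
  letI : AddCommGroup M := Module.addCommMonoidToAddCommGroup ℂ
  exists_extension_topologicalClosure (B₁ := G₁ →L[ℂ] G₁) (B₂ := G₂ →L[ℂ] G₂) φ ψ h W₁ hW₁ W₂ hW₂ hψ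

theorem exists_isAmpliation {μ : V →ₗ[ℂ] (E →L[ℂ] E)} (hμ : IsCompletelyBounded μ) (H : Type*)
    [NormedAddCommGroup H] [InnerProductSpace ℂ H] :
    ∃ T : minTensor V H →L[ℂ] minTensor (⊤ : Submodule ℂ (E →L[ℂ] E)) H, IsAmpliation μ T := by
  obtain ⟨C, hC⟩ := hμ
  have hbound : ∀ t, ‖algAmpliation μ H t‖ ≤ max C 0 * ‖algAmpliation V.subtype H t‖ :=
    norm_algAmpliation_le (le_max_right _ _) fun m a => (hC m a).trans (by gcongr; simp)
  have hW : minTensor V H = (LinearMap.range (algAmpliation V.subtype H)).topologicalClosure :=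
    congrArg Submodule.topologicalClosure range_algAmpliation_subtype.symm
  have hψ : ∀ t, algAmpliation μ H t ∈ minTensor (⊤ : Submodule ℂ (E →L[ℂ] E)) H :=
    algAmpliation_mem_minTensor μ fun _ => trivial
  obtain ⟨T, hT⟩ := exists_extension_topologicalClosure_clm (G₁ := HTensor K H) (G₂ := HTensor E H)
    (algAmpliation V.subtype H) (algAmpliation μ H) hbound (minTensor V H) hW
    (minTensor (⊤ : Submodule ℂ (E →L[ℂ] E)) H) (Submodule.isClosed_topologicalClosure _) hψ
  refine ⟨T, fun A Y => ?_⟩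
  have h := hT (A ⊗ₜ Y) (algAmpliation_mem_minTensor V.subtype (fun A => A.2) _)
  simpa only [algAmpliation_tmul, Submodule.subtype_apply] using h

theorem isAmpliation_ampliation {μ : V →ₗ[ℂ] (E →L[ℂ] E)} (hμ : IsCompletelyBounded μ)
    (H : Type*) [NormedAddCommGroup H] [InnerProductSpace ℂ H] :
    IsAmpliation μ (ampliation μ H) := by
  rw [ampliation, dif_pos (exists_isAmpliation hμ H)]
  exact (exists_isAmpliation hμ H).choose_spec

theorem IsAmpliation.apply_algAmpliation {μ : V →ₗ[ℂ] (E →L[ℂ] E)}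
    {T : minTensor V H →L[ℂ] minTensor (⊤ : Submodule ℂ (E →L[ℂ] E)) H} (hT : IsAmpliation μ T)
    (t : V ⊗[ℂ] (H →L[ℂ] H)) (ht : algAmpliation V.subtype H t ∈ minTensor V H) :
    (T ⟨algAmpliation V.subtype H t, ht⟩ : HTensor E H →L[ℂ] HTensor E H) =
      algAmpliation μ H t := by
  have key : (minTensor ⊤ H).subtype ∘ₗ T.toLinearMap ∘ₗ
      (algAmpliation V.subtype H).codRestrict _
        (algAmpliation_mem_minTensor V.subtype fun A => A.2) = algAmpliation μ H := by
    refine TensorProduct.ext' fun A Y => ?_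
    rw [algAmpliation_tmul]
    refine Eq.trans ?_ (hT A Y)
    simp only [LinearMap.comp_apply, Submodule.subtype_apply, ContinuousLinearMap.coe_coe]
    congr 2
  exact LinearMap.congr_fun key t

/-- A positive operator `Z` in the closure of an operator system `S` is the limit of positive
elements of `S`: if `Zₙ → Z`, then `Re Zₙ + ‖Zₙ - Z‖ ≥ Z ≥ 0`. -/
theorem exists_seq_isPositive_tendsto {G : Type*} [NormedAddCommGroup G] [InnerProductSpace ℂ G]
    [CompleteSpace G] {S : Submodule ℂ (G →L[ℂ] G)} (h1 : 1 ∈ S) (hstar : ∀ A ∈ S, star A ∈ S)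
    {Z : G →L[ℂ] G} (hcl : Z ∈ S.topologicalClosure) (hZ : Z.IsPositive) :
    ∃ w : ℕ → (G →L[ℂ] G), (∀ p, w p ∈ S) ∧ (∀ p, (w p).IsPositive) ∧
      Filter.Tendsto w Filter.atTop (nhds Z) := by
  obtain ⟨z, hzS, hz⟩ := mem_closure_iff_seq_limit.1 hcl
  let w : ℕ → (G →L[ℂ] G) := fun p =>
    (2⁻¹ : ℂ) • (z p + star (z p)) + ((‖z p - Z‖ : ℝ) : ℂ) • 1
  have hZsa : star Z = Z := hZ.isSelfAdjoint
  refine ⟨w, fun p => add_mem (S.smul_mem _ (add_mem (hzS p) (hstar _ (hzS p))))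
    (S.smul_mem _ h1), fun p => ?_, ?_⟩
  · have hd : w p = Z + ((2⁻¹ : ℂ) • ((z p - Z) + star (z p - Z)) +
        ((‖z p - Z‖ : ℝ) : ℂ) • 1) := by
      simp only [w, star_sub, hZsa]
      module
    rw [hd]
    refine hZ.add (isPositive_iff_inner_nonneg.2 fun x => ?_)
    generalize z p - Z = D
    have e1 : inner ℂ x ((star D) x) = (starRingEnd ℂ) (inner ℂ x (D x)) := by
      rw [ContinuousLinearMap.star_eq_adjoint, ContinuousLinearMap.adjoint_inner_right,
        inner_conj_symm]
    have e2 : inner ℂ x (((2⁻¹ : ℂ) • (D + star D) + ((‖D‖ : ℝ) : ℂ) • 1 : G →L[ℂ] G) x) =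
        (((inner ℂ x (D x)).re + ‖D‖ * ‖x‖ ^ 2 : ℝ) : ℂ) := by
      simp only [add_apply, smul_apply, inner_add_right, inner_smul_right, e1,
        Complex.add_conj, one_apply_eq_self, inner_self_eq_norm_sq_to_K]
      push_cast
      simp
    rw [e2, Complex.zero_le_real]
    have e3 : |(inner ℂ x (D x)).re| ≤ ‖D‖ * ‖x‖ ^ 2 := by
      refine (Complex.abs_re_le_norm _).trans ((norm_inner_le_norm _ _).trans ?_)
      calc ‖x‖ * ‖D x‖ ≤ ‖x‖ * (‖D‖ * ‖x‖) := by gcongr; exact D.le_opNorm x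
        _ = _ := by ring
    linarith [neg_le_of_abs_le e3]
  · have ht1 : Filter.Tendsto (fun p => ((‖z p - Z‖ : ℝ) : ℂ)) Filter.atTop (nhds 0) := by
      have := (hz.sub_const Z).norm
      rw [sub_self, norm_zero] at this
      exact (Complex.continuous_ofReal.tendsto 0).comp this
    have h := ((hz.add hz.star).const_smul (2⁻¹ : ℂ)).add
      (ht1.smul_const (1 : G →L[ℂ] G))
    rw [hZsa, zero_smul, add_zero, ← two_smul ℂ Z, smul_smul] at h
    simpa [w] using h

/-- The ampliation of a completely positive map on an operator system is positive on the whole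
minimal tensor product, not only on the algebraic one. -/
theorem IsAmpliation.isPositive [CompleteSpace K] [CompleteSpace H] {μ : V →ₗ[ℂ] (E →L[ℂ] E)}
    (hμ : IsCompletelyPositive μ) (h1 : 1 ∈ V) (hstar : ∀ A ∈ V, star A ∈ V)
    {T : minTensor V H →L[ℂ] minTensor (⊤ : Submodule ℂ (E →L[ℂ] E)) H} (hT : IsAmpliation μ T)
    (Z : minTensor V H) (hZ : (Z : HTensor K H →L[ℂ] HTensor K H).IsPositive) :
    (T Z : HTensor E H →L[ℂ] HTensor E H).IsPositive := by
  have hSstar : ∀ W ∈ LinearMap.range (algAmpliation V.subtype H),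
      star W ∈ LinearMap.range (algAmpliation V.subtype H) := by
    rintro _ ⟨t, rfl⟩
    induction t using TensorProduct.induction_on with
    | zero =>
      rw [map_zero, ContinuousLinearMap.star_eq_adjoint, map_zero]
      exact zero_mem _
    | add s t hs ht =>
      rw [ContinuousLinearMap.star_eq_adjoint] at hs ht ⊢
      rw [map_add, map_add]
      exact add_mem hs ht
    | tmul A Y =>
      exact ⟨(⟨star (A : K →L[ℂ] K), hstar _ A.2⟩ : V) ⊗ₜ star Y, by simp [star_opTensor]⟩
  have hSone : 1 ∈ LinearMap.range (algAmpliation V.subtype H) :=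
    ⟨(⟨1, h1⟩ : V) ⊗ₜ 1, by simp⟩
  have hSle : ∀ W ∈ LinearMap.range (algAmpliation V.subtype H), W ∈ minTensor V H := by
    rintro _ ⟨t, rfl⟩
    exact algAmpliation_mem_minTensor V.subtype (fun A => A.2) t
  have hcl : (Z : HTensor K H →L[ℂ] HTensor K H) ∈
      (LinearMap.range (algAmpliation V.subtype H)).topologicalClosure := by
    rw [range_algAmpliation_subtype]; exact Z.2
  obtain ⟨w, hwS, hwpos, hwlim⟩ := exists_seq_isPositive_tendsto (G := HTensor K H)
    hSone hSstar hcl hZ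
  have hTpos : ∀ p, (T ⟨w p, hSle _ (hwS p)⟩ : HTensor E H →L[ℂ] HTensor E H).IsPositive := by
    intro p
    obtain ⟨t, ht⟩ := hwS p
    have hp := hwpos p
    have hmem := hSle _ (hwS p)
    rw [← ht] at hp
    have : (⟨w p, hSle _ (hwS p)⟩ : minTensor V H) =
        ⟨algAmpliation V.subtype H t, by rw [ht]; exact hmem⟩ := Subtype.ext ht.symm
    rw [this, hT.apply_algAmpliation]
    exact algAmpliation_isPositive hμ hp
  have hlim : Filter.Tendsto (fun p => (T ⟨w p, hSle _ (hwS p)⟩ :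
      HTensor E H →L[ℂ] HTensor E H)) Filter.atTop (nhds (T Z)) :=
    (continuous_subtype_val.tendsto _).comp
      ((T.continuous.tendsto Z).comp (tendsto_subtype_rng.2 hwlim))
  refine isPositive_iff_inner_nonneg.2 fun x => ?_
  refine ge_of_tendsto' (x := Filter.atTop) (f := fun p => inner ℂ x
    ((T ⟨w p, hSle _ (hwS p)⟩ : HTensor E H →L[ℂ] HTensor E H) x)) ?_
    fun p => (hTpos p).inner_nonneg_right x
  have hc : Continuous fun A : HTensor E H →L[ℂ] HTensor E H => (inner ℂ x (A x) : ℂ) := by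
    fun_prop
  exact (hc.tendsto _).comp hlim

/-- Restricting the ampliation of an extension of `μ` gives the ampliation of `μ`. -/
theorem ampliationAt_eq_of_extends {V W : Submodule ℂ (K →L[ℂ] K)} (hVW : V ≤ W)
    {μ : V →ₗ[ℂ] (E →L[ℂ] E)} {ν : W →ₗ[ℂ] (E →L[ℂ] E)} (hμ : IsCompletelyBounded μ) (hν : IsCompletelyBounded ν)
    (h : ∀ A : V, ν ⟨A, hVW A.2⟩ = μ A) {Z : HTensor K H →L[ℂ] HTensor K H}
    (hZ : Z ∈ minTensor V H) : ampliationAt μ Z = ampliationAt ν Z := by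
  have hle : minTensor V H ≤ minTensor W H := by
    refine Submodule.topologicalClosure_mono (Submodule.span_mono ?_)
    rintro _ ⟨A, hA, Y, rfl⟩
    exact ⟨A, hVW hA, Y, rfl⟩
  let ι : minTensor V H →L[ℂ] minTensor W H :=
    ⟨Submodule.inclusion hle, continuous_inclusion hle⟩
  have hT : IsAmpliation μ (ampliation ν H ∘L ι) := fun A Y => by
    rw [← h A]
    exact isAmpliation_ampliation hν H ⟨A, hVW A.2⟩ Y
  rw [ampliationAt, ampliationAt, dif_pos hZ, dif_pos (hle hZ),
    (isAmpliation_ampliation hμ H).unique hT]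
  rfl

end Ampliation

/-! ### The Poisson series in a Banach algebra -/

section PoissonSeries

theorem summable_norm_pow {B : Type*} [NormedRing B] {x : B} (hx : ‖x‖ < 1) :
    Summable fun p : ℕ => ‖x ^ p‖ := by
  refine Summable.of_norm_bounded_eventually_nat
    (summable_geometric_of_lt_one (norm_nonneg x) hx) ?_
  filter_upwards [Filter.eventually_gt_atTop 0] with p hp
  rw [norm_norm]
  exact norm_pow_le' x hp

theorem summable_norm_int_pow {B : Type*} [NormedRing B] {x y : B} (hx : ‖x‖ < 1)
    (hy : ‖y‖ < 1) : Summable fun m : ℤ => ‖x ^ (-m).toNat * y ^ m.toNat‖ := by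
  refine Summable.of_nat_of_neg ?_ ?_
  · simpa using summable_norm_pow hy
  · simpa using summable_norm_pow hx

theorem commute_one_sub_right {R : Type*} [Ring R] {x y : R} (h : Commute x y) :
    Commute x (1 - y) :=
  (Commute.one_right x).sub_right h

theorem commute_one_sub_one_sub {R : Type*} [Ring R] {x y : R} (h : Commute x y) :
    Commute (1 - x) (1 - y) :=
  (commute_one_sub_right (commute_one_sub_right h).symm).symm

/-- The one-variable Poisson series `∑ m, x^{m⁻} y^{m⁺} = (1 - x)⁻¹ + (1 - y)⁻¹ - 1`. -/
theorem one_sub_mul_one_sub_mul_tsum_int_pow {B : Type*} [NormedRing B] [CompleteSpace B] {x y : B}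
    (hxy : Commute x y) (hx : ‖x‖ < 1) (hy : ‖y‖ < 1) :
    (1 - x) * (1 - y) * ∑' m : ℤ, x ^ (-m).toNat * y ^ m.toNat = 1 - x * y := by
  have h1 : HasSum (fun p : ℕ => x ^ (-(p : ℤ)).toNat * y ^ (p : ℤ).toNat) (∑' p : ℕ, y ^ p) := by
    simpa using (summable_geometric_of_norm_lt_one hy).hasSum
  have h2 : HasSum (fun p : ℕ => x ^ (-(-((p : ℤ) + 1))).toNat * y ^ (-((p : ℤ) + 1)).toNat)
      (x * ∑' p : ℕ, x ^ p) := by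
    -- The index `-(p + 1)` contributes `x ^ (p + 1)`.
    have e : (fun p : ℕ => x ^ (-(-((p : ℤ) + 1))).toNat * y ^ (-((p : ℤ) + 1)).toNat) =
        fun p => x * x ^ p := by
      funext p
      have e1 : (-(-((p : ℤ) + 1))).toNat = p + 1 := by omega
      have e2 : (-((p : ℤ) + 1)).toNat = 0 := by omega
      rw [e1, e2, pow_zero, mul_one, pow_succ']
    rw [e]
    exact (summable_geometric_of_norm_lt_one hx).hasSum.mul_left x
  have hy' : (1 - y) * ∑' p : ℕ, y ^ p = 1 := mul_neg_geom_series y hy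
  have hx' : (1 - x) * ∑' p : ℕ, x ^ p = 1 := mul_neg_geom_series x hx
  have h3 : Commute (1 - x) ((1 - y) * x) :=
    (commute_one_sub_one_sub hxy).mul_right (commute_one_sub_right (Commute.refl x)).symm
  have h := HasSum.of_nat_of_neg_add_one (f := fun m : ℤ => x ^ (-m).toNat * y ^ m.toNat) h1 h2
  rw [h.tsum_eq, mul_add, mul_assoc, hy', mul_one,
    ← mul_assoc ((1 - x) * (1 - y)), mul_assoc (1 - x), h3.eq, mul_assoc, hx', mul_one, sub_mul,
    one_mul, hxy.eq, sub_add_sub_cancel]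

variable {A : Type*} [NormedRing A] [NormedAlgebra ℂ A] {k : ℕ}

theorem prod_ofFn_mulLeft_apply (g : Fin k → A) (z : A) :
    (List.ofFn fun i => ContinuousLinearMap.mul ℂ A (g i)).prod z = (List.ofFn g).prod * z := by
  induction k with
  | zero => simp
  | succ k ih => simp [List.ofFn_succ, ih, mul_assoc]

/-- The ordered product of right multiplications multiplies on the right in the opposite order,
which does not matter for commuting factors. -/
theorem prod_ofFn_mulRight_apply {g : Fin k → A} (hg : ∀ i j, i ≠ j → Commute (g i) (g j)) (z : A) :
    (List.ofFn fun i => (ContinuousLinearMap.mul ℂ A).flip (g i)).prod z =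
      z * (List.ofFn g).prod := by
  induction k with
  | zero => simp
  | succ k ih =>
    have hc : Commute (g 0) (List.ofFn fun i : Fin k => g i.succ).prod :=
      commute_prod_ofFn fun i => hg _ _ (Fin.succ_ne_zero i).symm
    simp only [List.ofFn_succ, List.prod_cons, mul_apply_eq_comp, hc.eq]
    rw [ih fun i j hij => hg _ _ (by simpa using hij)]
    simp [mul_assoc]

theorem mulLeft_pow (x : A) (p : ℕ) :
    ContinuousLinearMap.mul ℂ A x ^ p = ContinuousLinearMap.mul ℂ A (x ^ p) := by
  induction p with
  | zero => ext; simp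
  | succ p ih => rw [pow_succ, ih]; ext; simp [pow_succ, mul_assoc]

theorem mulRight_pow (x : A) (p : ℕ) :
    (ContinuousLinearMap.mul ℂ A).flip x ^ p = (ContinuousLinearMap.mul ℂ A).flip (x ^ p) := by
  induction p with
  | zero => ext; simp
  | succ p ih => rw [pow_succ, ih]; ext; simp [pow_succ', mul_assoc]

theorem commute_mulLeft_mulRight (x y : A) :
    Commute (ContinuousLinearMap.mul ℂ A x) ((ContinuousLinearMap.mul ℂ A).flip y) := by
  ext; simp [mul_assoc]

theorem commute_mulLeft {x y : A} (h : Commute x y) :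
    Commute (ContinuousLinearMap.mul ℂ A x) (ContinuousLinearMap.mul ℂ A y) := by
  ext; simp [← mul_assoc, h.eq]

theorem commute_mulRight {x y : A} (h : Commute x y) :
    Commute ((ContinuousLinearMap.mul ℂ A).flip x) ((ContinuousLinearMap.mul ℂ A).flip y) := by
  ext; simp [mul_assoc, h.eq]

theorem prod_ofFn_one_sub_mulLeftRight_apply (a b : Fin k → A) (z : A) :
    (List.ofFn fun i => 1 - ContinuousLinearMap.mul ℂ A (a i) *
      (ContinuousLinearMap.mul ℂ A).flip (b i)).prod z =
    (List.ofFn fun i => (1 : Module.End ℂ A) - LinearMap.mulLeftRight ℂ (a i, b i)).prod z := by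
  induction k with
  | zero => simp
  | succ k ih => simp [List.ofFn_succ, ih, mul_assoc]

/-- The Poisson series of two commuting tuples.  Left multiplications commute with right
multiplications, so inside `A →L[ℂ] A` the series is a product of one-variable series. -/
theorem exists_hasSum_poisson [CompleteSpace A] {a b : Fin k → A}
    (ha : ∀ i j, i ≠ j → Commute (a i) (a j)) (hb : ∀ i j, i ≠ j → Commute (b i) (b j))
    (na : ∀ i, ‖a i‖ < 1) (nb : ∀ i, ‖b i‖ < 1) :
    ∃ P : A, HasSum (fun m : Fin k → ℤ => (List.ofFn fun i => a i ^ (-(m i)).toNat).prod *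
        (List.ofFn fun i => b i ^ (m i).toNat).prod) P ∧
      (List.ofFn fun i => 1 - a i).prod * P * (List.ofFn fun i => 1 - b i).prod =
        (List.ofFn fun i => (1 : Module.End ℂ A) - LinearMap.mulLeftRight ℂ (a i, b i)).prod 1 := by
  let L : Fin k → (A →L[ℂ] A) := fun i => ContinuousLinearMap.mul ℂ A (a i)
  let R : Fin k → (A →L[ℂ] A) := fun i => (ContinuousLinearMap.mul ℂ A).flip (b i)
  have nL : ∀ i, ‖L i‖ < 1 := fun i =>
    (ContinuousLinearMap.opNorm_mul_apply_le ℂ A _).trans_lt (na i)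
  have nR : ∀ i, ‖R i‖ < 1 := fun i =>
    (ContinuousLinearMap.opNorm_le_bound _ (norm_nonneg (b i)) fun z => by
      simpa [R, mul_comm] using norm_mul_le z (b i)).trans_lt (nb i)
  have hLL : ∀ i j, i ≠ j → Commute (L i) (L j) := fun i j h => commute_mulLeft (ha i j h)
  have hRR : ∀ i j, i ≠ j → Commute (R i) (R j) := fun i j h => commute_mulRight (hb i j h)
  have hLR : ∀ i j, Commute (L i) (R j) := fun i j => commute_mulLeft_mulRight _ _
  let f : Fin k → ℤ → (A →L[ℂ] A) := fun i m => L i ^ (-m).toNat * R i ^ m.toNat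
  have hf : ∀ i, Summable fun m => ‖f i m‖ := fun i => summable_norm_int_pow (nL i) (nR i)
  obtain ⟨-, hS⟩ := hasSum_prod_ofFn f hf
  set S := (List.ofFn fun i => ∑' m, f i m).prod with hSdef
  have hpowR : ∀ (p : Fin k → ℕ) (i j : Fin k), i ≠ j → Commute (b i ^ p i) (b j ^ p j) :=
    fun p i j h => (hb i j h).pow_pow _ _
  refine ⟨S 1, ?_, ?_⟩
  · have h := hS.mapL (ContinuousLinearMap.apply ℂ A (1 : A))
    convert! h using 2 with m
    have e : (List.ofFn fun i => f i (m i)).prod =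
        (List.ofFn fun i => L i ^ (-(m i)).toNat).prod *
          (List.ofFn fun i => R i ^ (m i).toNat).prod :=
      prod_ofFn_mul fun i j _ => ((hLR j i).symm.pow_pow _ _)
    rw [ContinuousLinearMap.apply_apply, e, mul_apply_eq_comp]
    simp only [L, R, mulLeft_pow, mulRight_pow]
    rw [prod_ofFn_mulRight_apply (hpowR _), prod_ofFn_mulLeft_apply, one_mul]
  · have e1 : (List.ofFn fun i => 1 - L i).prod * (List.ofFn fun i => 1 - R i).prod * S =
        (List.ofFn fun i => 1 - L i * R i).prod := by
      have hxy : ∀ i j, i ≠ j → Commute (1 - R i) (1 - L j) := fun i j _ =>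
        (Commute.one_left _).sub_left ((Commute.one_right _).sub_right (hLR j i).symm)
      have hzxy : ∀ i j, i ≠ j → Commute (∑' m, f i m) ((1 - L j) * (1 - R j)) := fun i j h =>
        Commute.tsum_left _ fun m =>
          (commute_one_sub_right
            (((hLL i j h).pow_left _).mul_left ((hLR j i).symm.pow_left _))).mul_right
          (commute_one_sub_right (((hLR i j).pow_left _).mul_left ((hRR i j h).pow_left _)))
      rw [← prod_ofFn_mul hxy, hSdef, ← prod_ofFn_mul hzxy]
      congr 2
      funext i
      exact one_sub_mul_one_sub_mul_tsum_int_pow (hLR i i) (nL i) (nR i)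
    have hL' : ∀ i, 1 - L i = ContinuousLinearMap.mul ℂ A (1 - a i) := fun i => by
      ext; simp [L]
    have hR' : ∀ i, 1 - R i = (ContinuousLinearMap.mul ℂ A).flip (1 - b i) := fun i => by
      ext; simp [R]
    have e2 := congrArg (fun Φ : A →L[ℂ] A => Φ 1) e1
    simp only [L, R, prod_ofFn_one_sub_mulLeftRight_apply] at e2
    rw [← e2]
    change _ = ((List.ofFn fun i => 1 - L i).prod * (List.ofFn fun i => 1 - R i).prod * S) 1
    simp only [hL', hR', mul_apply_eq_comp]
    rw [prod_ofFn_mulRight_apply fun i j h => commute_one_sub_one_sub (hb i j h),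
      prod_ofFn_mulLeft_apply, mul_assoc]

/-- The factorization of the Poisson series of a commuting tuple of strict contractions: with
`D = (id - Θ₁) ∘ ⋯ ∘ (id - Θₖ) (1)`, `Θᵢ(Z) = Tᵢ^* Z Tᵢ`, its sum is `C^* D C` for
`C = ∏ (1 - Tᵢ)⁻¹`. -/
theorem hasSum_poisson_of_commute {G : Type*} [NormedAddCommGroup G] [InnerProductSpace ℂ G]
    [CompleteSpace G] {k : ℕ} {T : Fin k → (G →L[ℂ] G)}
    (hT : ∀ i j, i ≠ j → Commute (T i) (T j)) (nT : ∀ i, ‖T i‖ < 1) :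
    (∀ i, IsUnit (1 - T i)) ∧
      HasSum (fun m : Fin k → ℤ => (List.ofFn fun i => star (T i) ^ (-(m i)).toNat).prod *
        (List.ofFn fun i => T i ^ (m i).toNat).prod)
        (star (List.ofFn fun i => Ring.inverse (1 - T i)).prod *
          (List.ofFn fun i => (1 : Module.End ℂ (G →L[ℂ] G)) -
            LinearMap.mulLeftRight ℂ (star (T i), T i)).prod 1 *
          (List.ofFn fun i => Ring.inverse (1 - T i)).prod) := by
  have hu : ∀ i, IsUnit (1 - T i) := fun i => isUnit_one_sub_of_norm_lt_one (nT i)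
  refine ⟨hu, ?_⟩
  obtain ⟨P, hP, hPe⟩ := exists_hasSum_poisson (a := fun i => star (T i)) (b := T)
    (fun i j h => (hT i j h).star_star) hT (fun i => by rw [norm_star]; exact nT i) nT
  have hc : ∀ i j, i ≠ j → Commute (1 - T i) (1 - T j) := fun i j h =>
    commute_one_sub_one_sub (hT i j h)
  have hr : (List.ofFn fun i => 1 - T i).prod * (List.ofFn fun i => Ring.inverse (1 - T i)).prod =
      1 := by
    have hinv : ∀ i j, i ≠ j → Commute (Ring.inverse (1 - T i)) (1 - T j) := fun i j h => by
      obtain ⟨u, hu'⟩ := hu i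
      have := hc i j h
      rw [← hu'] at this ⊢
      rw [Ring.inverse_unit]
      exact this.units_inv_left
    rw [← prod_ofFn_mul hinv]
    simp [fun i => Ring.mul_inverse_cancel _ (hu i)]
  have hs : (List.ofFn fun i => 1 - star (T i)).prod = star (List.ofFn fun i => 1 - T i).prod := by
    rw [star_prod_ofFn hc]
    simp
  rw [← hPe, hs]
  have e : star (List.ofFn fun i => Ring.inverse (1 - T i)).prod *
      (star (List.ofFn fun i => 1 - T i).prod * P * (List.ofFn fun i => 1 - T i).prod) *
      (List.ofFn fun i => Ring.inverse (1 - T i)).prod = P :=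
    calc _ = star ((List.ofFn fun i => 1 - T i).prod *
            (List.ofFn fun i => Ring.inverse (1 - T i)).prod) * P *
          ((List.ofFn fun i => 1 - T i).prod *
            (List.ofFn fun i => Ring.inverse (1 - T i)).prod) := by
          simp only [star_mul, mul_assoc]
      _ = P := by rw [hr, star_one, one_mul, mul_one]
  rw [e]
  exact hP

end PoissonSeries

/-! ### The right creation operators -/

section Fock

variable {k : ℕ} {n : Fin k → ℕ}

theorem fock_clm_ext {S T : Fock n →L[ℂ] Fock n}
    (h : ∀ α, S (fockBasis n α) = T (fockBasis n α)) : S = T := by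
  classical
  refine lp.ext_continuousLinearMap ENNReal.ofNat_ne_top fun α => ?_
  ext1
  simpa [fockBasis] using h α

theorem inner_fockBasis_left (α : (i : Fin k) → FreeMonoid (Fin (n i))) (f : Fock n) :
    inner ℂ (fockBasis n α) f = f α := by
  classical
  rw [fockBasis, lp.inner_single_left]
  simp

/-- For each `i`, the `R_{i,j}` are isometries with orthogonal ranges. -/
theorem star_rightCreation_mul_rightCreation (i : Fin k) (j l : Fin (n i)) :
    star (rightCreation n i j) * rightCreation n i l = if j = l then 1 else 0 := by
  classical
  refine fock_clm_ext fun β => ?_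
  ext α
  rw [← inner_fockBasis_left, ← inner_fockBasis_left, mul_apply_eq_comp,
    ContinuousLinearMap.star_eq_adjoint, ContinuousLinearMap.adjoint_inner_right,
    rightCreation_fockBasis, rightCreation_fockBasis,
    orthonormal_iff_ite.1 (orthonormal_fockBasis n)]
  -- Comparing last letters, `α_i g_j = β_i g_l` forces `j = l`.
  have key : appendLetter i j α = appendLetter i l β ↔ j = l ∧ α = β := by
    refine ⟨fun h => ?_, by rintro ⟨rfl, rfl⟩; rfl⟩
    have hi := congrFun h i
    simp only [appendLetter, Function.update_self] at hi
    have hjl : j = l := by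
      have := congrArg (fun w => (FreeMonoid.toList w).getLast?) hi
      simpa using this
    subst hjl
    exact ⟨rfl, appendLetter_injective i j h⟩
  split_ifs with h1 h2 h2
  · rw [one_apply_eq_self, orthonormal_iff_ite.1 (orthonormal_fockBasis n), if_pos (key.1 h1).2]
  · exact absurd (key.1 h1).1 h2
  · rw [one_apply_eq_self, orthonormal_iff_ite.1 (orthonormal_fockBasis n),
      if_neg fun h => h1 (key.2 ⟨h2, h⟩)]
  · simp

theorem commute_rightCreation {i s : Fin k} (h : i ≠ s) (j : Fin (n i)) (l : Fin (n s)) :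
    Commute (rightCreation n i j) (rightCreation n s l) := by
  refine fock_clm_ext fun α => ?_
  simp only [mul_apply_eq_comp, rightCreation_fockBasis, appendLetter]
  rw [Function.update_of_ne h, Function.update_of_ne h.symm, Function.update_comm h]

theorem commute_lift {M : Type*} [Monoid M] {p q : Type*} {x : p → M} {y : q → M}
    (h : ∀ a b, Commute (x a) (y b)) (v : FreeMonoid p) (w : FreeMonoid q) :
    Commute (FreeMonoid.lift x v) (FreeMonoid.lift y w) := by
  induction v using FreeMonoid.inductionOn' with
  | one => simp
  | of_mul a v hv =>
    rw [map_mul, FreeMonoid.lift_eval_of]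
    refine Commute.mul_left ?_ hv
    clear hv
    induction w using FreeMonoid.inductionOn' with
    | one => simp
    | of_mul b w hw =>
      rw [map_mul, FreeMonoid.lift_eval_of]
      exact (h a b).mul_right hw

theorem star_wordProd {H : Type*} [NormedAddCommGroup H] [InnerProductSpace ℂ H] [CompleteSpace H]
    {X : OpTuple n H} (hX : ∀ s t, s ≠ t → ∀ p q, Commute (X s p) (X t q))
    (α : (i : Fin k) → FreeMonoid (Fin (n i))) : star (wordProd X α) = wordProdStar X α :=
  star_prod_ofFn fun i j h => commute_lift (hX i j h) _ _

theorem poissonCoeff_mem_starSpan (α β : (i : Fin k) → FreeMonoid (Fin (n i))) :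
    poissonCoeff n α β ∈ starSpan n := by
  refine Submodule.subset_span ⟨fun i => (α i).reverse, fun i => (β i).reverse, ?_⟩
  rw [star_wordProd fun s t h p q => commute_rightCreation h p q]
  rfl

theorem one_mem_starSpan : 1 ∈ starSpan n :=
  Submodule.subset_span ⟨1, 1, by simp [wordProd]⟩

theorem star_mem_starSpan {A : Fock n →L[ℂ] Fock n} (hA : A ∈ starSpan n) :
    star A ∈ starSpan n := by
  induction hA using Submodule.span_induction with
  | mem A h =>
    obtain ⟨α, β, rfl⟩ := h
    exact Submodule.subset_span ⟨β, α, by simp⟩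
  | zero => simp
  | add A B _ _ hA hB => rw [star_add]; exact add_mem hA hB
  | smul c A _ hA => rw [star_smul]; exact Submodule.smul_mem _ _ hA

end Fock

/-! ### The Poisson kernel -/

section Kernel

variable {k : ℕ} {n : Fin k → ℕ} {H : Type*} [NormedAddCommGroup H] [InnerProductSpace ℂ H]
  [CompleteSpace H]

/-- The operator `T_i = ∑ j, R_{i,j} ⊗ X_{i,j}^*`. -/
noncomputable def rowOp (X : OpTuple n H) (i : Fin k) :
    HTensor (Fock n) H →L[ℂ] HTensor (Fock n) H :=
  ∑ j, opTensor (rightCreation n i j) (star (X i j))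

theorem star_sum_opTensor {E : Type*} [NormedAddCommGroup E] [InnerProductSpace ℂ E]
    [CompleteSpace E] {ι : Type*} (s : Finset ι) (A : ι → (E →L[ℂ] E)) (Y : ι → (H →L[ℂ] H)) :
    star (∑ c ∈ s, opTensor (A c) (Y c)) = ∑ c ∈ s, opTensor (star (A c)) (star (Y c)) := by
  rw [ContinuousLinearMap.star_eq_adjoint, map_sum]
  simp only [← ContinuousLinearMap.star_eq_adjoint, star_opTensor]

/-- `T_i` intertwines the maps `Z ↦ T_i^* Z T_i` and `Φ_{X_i}` through `Y ↦ I ⊗ Y`. -/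
theorem star_rowOp_mul_opTensor_one_mul_rowOp (X : OpTuple n H) (i : Fin k) (Y : H →L[ℂ] H) :
    star (rowOp X i) * opTensor 1 Y * rowOp X i = opTensor 1 (cpMap X i Y) := by
  rw [rowOp, star_sum_opTensor, Finset.sum_mul, Finset.sum_mul_sum]
  simp only [opTensor_mul, mul_one, star_star, star_rightCreation_mul_rightCreation, cpMap,
    LinearMap.sum_apply, LinearMap.mulLeftRight_apply, opTensor_sum_right]
  refine Finset.sum_congr rfl fun j _ => ?_
  rw [Finset.sum_eq_single j]
  · simp
  · intro l _ hl
    rw [if_neg hl.symm, opTensor_zero_left]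
  · simp

theorem norm_rowOp_lt_one {X : OpTuple n H} {i : Fin k}
    (h : ‖∑ j, X i j * star (X i j)‖ < 1) : ‖rowOp X i‖ < 1 := by
  have h1 : star (rowOp X i) * rowOp X i = opTensor 1 (∑ j, X i j * star (X i j)) := by
    have := star_rowOp_mul_opTensor_one_mul_rowOp X i 1
    rw [opTensor_one, mul_one] at this
    rw [this]
    simp [cpMap]
  have h2 : ‖rowOp X i‖ * ‖rowOp X i‖ < 1 := by
    have h3 : ‖star (rowOp X i) * rowOp X i‖ = ‖rowOp X i‖ * ‖rowOp X i‖ :=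
      CStarRing.norm_star_mul_self (x := rowOp X i)
    rw [← h3, h1]
    refine (norm_opTensor_le _ _).trans_lt ?_
    refine lt_of_le_of_lt ?_ h
    exact mul_le_of_le_one_left (norm_nonneg _) ContinuousLinearMap.norm_id_le
  nlinarith [norm_nonneg (rowOp X i)]

theorem commute_rowOp {X : OpTuple n H} (hX : ∀ s t, s ≠ t → ∀ p q, Commute (X s p) (X t q))
    {s t : Fin k} (h : s ≠ t) : Commute (rowOp X s) (rowOp X t) := by
  refine Commute.sum_left _ _ _ fun p _ => Commute.sum_right _ _ _ fun q _ => ?_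
  rw [Commute, SemiconjBy, opTensor_mul, opTensor_mul, (commute_rightCreation h p q).eq,
    (hX s t h p q).star_star.eq]

/-- Powers of a row operator, expanded along words.  Taking adjoints reverses words in the second
factor, so the first factor runs through the reversed words. -/
theorem sum_opTensor_pow {E : Type*} [NormedAddCommGroup E] [InnerProductSpace ℂ E] {d : ℕ}
    (r : Fin d → (E →L[ℂ] E)) (x : Fin d → (H →L[ℂ] H)) (p : ℕ) :
    (∑ j, opTensor (r j) (star (x j))) ^ p =
      ∑ c : Fin p → Fin d, opTensor
        (FreeMonoid.lift r (FreeMonoid.reverse (FreeMonoid.ofList (List.ofFn c))))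
        (star (FreeMonoid.lift x (FreeMonoid.ofList (List.ofFn c)))) := by
  induction p with
  | zero =>
    have h : FreeMonoid.reverse (1 : FreeMonoid (Fin d)) = 1 := rfl
    simp [h]
  | succ p ih =>
    -- The last factor supplies the first letter of the word.
    rw [pow_succ, ih, ← (Fin.consEquiv fun _ => Fin d).sum_comp, Fintype.sum_prod_type_right,
      Finset.sum_mul_sum]
    refine Finset.sum_congr rfl fun c _ => Finset.sum_congr rfl fun j _ => ?_
    rw [opTensor_mul]
    simp [List.ofFn_succ, Fin.consEquiv, FreeMonoid.ofList_cons, FreeMonoid.reverse_mul]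

theorem prod_rowOp_pow (X : OpTuple n H) (p : Fin k → ℕ) :
    (List.ofFn fun i => rowOp X i ^ p i).prod =
      ∑ b : (i : Fin k) → Fin (p i) → Fin (n i),
        opTensor (wordProd (rightCreation n) fun i => (wordsOf b i).reverse)
          (wordProdStar X (wordsOf b)) := by
  simp only [rowOp, sum_opTensor_pow]
  rw [prod_ofFn_sum]
  simp only [opTensor_listProd]
  rfl

theorem prod_star_rowOp_pow (X : OpTuple n H) (p : Fin k → ℕ) :
    (List.ofFn fun i => star (rowOp X i) ^ p i).prod =
      ∑ a : (i : Fin k) → Fin (p i) → Fin (n i),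
        opTensor (wordProdStar (rightCreation n) fun i => (wordsOf a i).reverse)
          (wordProd X (wordsOf a)) := by
  have h : ∀ i, star (rowOp X i) ^ p i = ∑ c : Fin (p i) → Fin (n i), opTensor
        (star (FreeMonoid.lift (rightCreation n i)
          (FreeMonoid.reverse (FreeMonoid.ofList (List.ofFn c)))))
        (FreeMonoid.lift (X i) (FreeMonoid.ofList (List.ofFn c))) := fun i => by
    rw [show star (rowOp X i) ^ p i = star (rowOp X i ^ p i) from (star_pow (rowOp X i) (p i)).symm,
      rowOp, sum_opTensor_pow, star_sum_opTensor]
    simp only [star_star]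
  simp only [h]
  rw [prod_ofFn_sum]
  simp only [opTensor_listProd]
  rfl

/-- The multi-homogeneous terms of the Poisson kernel are monomials in the `T_i^*` and the `T_i`. -/
theorem homogTerm_poissonCoeff (X : OpTuple n H) (m : Fin k → ℤ) :
    homogTerm (poissonCoeff n) X m =
      (List.ofFn fun i => star (rowOp X i) ^ (-(m i)).toNat).prod *
        (List.ofFn fun i => rowOp X i ^ (m i).toNat).prod := by
  rw [prod_rowOp_pow X fun i => (m i).toNat, prod_star_rowOp_pow X fun i => (-(m i)).toNat,
    Finset.sum_mul_sum]
  simp only [opTensor_mul]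
  rfl

/-- A map intertwining two families of endomorphisms intertwines their ordered products. -/
theorem prod_ofFn_end_apply {A B : Type*} [AddCommGroup A] [Module ℂ A] [AddCommGroup B]
    [Module ℂ B] {f : Fin k → Module.End ℂ A} {g : Fin k → Module.End ℂ B} {φ : A → B}
    (h : ∀ i a, g i (φ a) = φ (f i a)) (a : A) :
    (List.ofFn g).prod (φ a) = φ ((List.ofFn f).prod a) := by
  induction k with
  | zero => simp
  | succ k ih => simp [List.ofFn_succ, ih fun i => h i.succ, h]

/-- The defect map of the tuple `T_1^*, …, T_k^*` lies over the defect map of `X`. -/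
theorem prod_one_sub_mulLeftRight_rowOp (X : OpTuple n H) (Y : H →L[ℂ] H) :
    (List.ofFn fun i => (1 : Module.End ℂ (HTensor (Fock n) H →L[ℂ] HTensor (Fock n) H)) -
        LinearMap.mulLeftRight ℂ (star (rowOp X i), rowOp X i)).prod (opTensor 1 Y) =
      opTensor 1 (defectMap X Y) := by
  refine prod_ofFn_end_apply (fun i Z => ?_) Y
  rw [LinearMap.sub_apply, LinearMap.sub_apply, LinearMap.mulLeftRight_apply,
    star_rowOp_mul_opTensor_one_mul_rowOp]
  exact (map_sub (opTensorₗ (Fock n) H 1) Z (cpMap X i Z)).symm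

theorem star_cOp_mul_cOp {X : OpTuple n H} (hX : (defectMap X 1).IsPositive) :
    star (cOp X) * cOp X = star (List.ofFn fun i => Ring.inverse (resolventOp X i)).prod *
      opTensor 1 (defectMap X 1) * (List.ofFn fun i => Ring.inverse (resolventOp X i)).prod := by
  have h0 : 0 ≤ defectMap X 1 := (ContinuousLinearMap.nonneg_iff_isPositive _).2 hX
  have h1 : star (CFC.sqrt (defectMap X 1)) = CFC.sqrt (defectMap X 1) :=
    (IsSelfAdjoint.of_nonneg (CFC.sqrt_nonneg _)).star_eq
  set C := (List.ofFn fun i => Ring.inverse (resolventOp X i)).prod with hC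
  have h2 : cOp X = opTensor 1 (CFC.sqrt (defectMap X 1)) * C := rfl
  have h3 : star (cOp X) = star C * opTensor 1 (CFC.sqrt (defectMap X 1)) := by
    rw [h2]
    refine (star_mul (opTensor 1 (CFC.sqrt (defectMap X 1))) C).trans ?_
    rw [star_opTensor, star_one, h1]
  rw [h3, h2, mul_assoc, ← mul_assoc (opTensor 1 (CFC.sqrt (defectMap X 1))), opTensor_mul, mul_one,
    CFC.sqrt_mul_sqrt_self _ h0, mul_assoc]

/-- Convergence of the Poisson series and its factorization. -/
theorem isUnit_resolventOp_and_hasSum {X : OpTuple n H} (hX : IsInPolyball X) :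
    (∀ i, IsUnit (resolventOp X i)) ∧
      HasSum (homogTerm (poissonCoeff n) X) (star (cOp X) * cOp X) := by
  obtain ⟨h1, h2⟩ := hasSum_poisson_of_commute (G := HTensor (Fock n) H) (T := rowOp X)
    (fun i j h => commute_rowOp hX.commute h) fun i => norm_rowOp_lt_one (hX.norm_lt i)
  refine ⟨h1, ?_⟩
  have h3 := prod_one_sub_mulLeftRight_rowOp X 1
  rw [opTensor_one] at h3
  rw [h3] at h2
  rw [star_cOp_mul_cOp hX.defect_pos, funext (homogTerm_poissonCoeff X)]
  exact h2

theorem hasSum_poissonKernel {X : OpTuple n H} (hX : IsInPolyball X) :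
    HasSum (homogTerm (poissonCoeff n) X) (poissonKernel H X) :=
  (isUnit_resolventOp_and_hasSum hX).2.summable.hasSum

theorem poissonKernel_eq {X : OpTuple n H} (hX : IsInPolyball X) :
    poissonKernel H X = star (cOp X) * cOp X :=
  (isUnit_resolventOp_and_hasSum hX).2.tsum_eq

theorem isPositive_poissonKernel {X : OpTuple n H} (hX : IsInPolyball X) :
    (poissonKernel H X).IsPositive := by
  rw [poissonKernel_eq hX]
  exact ContinuousLinearMap.isPositive_adjoint_comp_self (cOp X)

theorem homogTerm_mem_minTensor {K : Type*} [NormedAddCommGroup K] [InnerProductSpace ℂ K]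
    {V : Submodule ℂ (K →L[ℂ] K)}
    {A : ((i : Fin k) → FreeMonoid (Fin (n i))) → ((i : Fin k) → FreeMonoid (Fin (n i))) →
      (K →L[ℂ] K)} (hA : ∀ α β, A α β ∈ V) (X : OpTuple n H) (m : Fin k → ℤ) :
    homogTerm A X m ∈ minTensor V H :=
  sum_mem fun _ _ => sum_mem fun _ _ => opTensor_mem_minTensor ⟨_, hA _ _⟩ _

theorem poissonKernel_mem_minTensor {X : OpTuple n H} (hX : IsInPolyball X) :
    poissonKernel H X ∈ minTensor (starSpan n) H :=
  (Submodule.isClosed_topologicalClosure _).mem_of_tendsto (hasSum_poissonKernel hX)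
    (Filter.Eventually.of_forall fun _ => sum_mem fun m _ =>
      homogTerm_mem_minTensor poissonCoeff_mem_starSpan X m)

end Kernel

/-! ### The Poisson transform -/

section Transform

variable {k : ℕ} {n : Fin k → ℕ} {H : Type*} [NormedAddCommGroup H] [InnerProductSpace ℂ H]
  [CompleteSpace H] {E : Type*} [NormedAddCommGroup E] [InnerProductSpace ℂ E]

/-- The ampliation acts on multi-homogeneous terms through the coefficients. -/
theorem IsAmpliation.apply_homogTerm {K : Type*} [NormedAddCommGroup K] [InnerProductSpace ℂ K]
    {V : Submodule ℂ (K →L[ℂ] K)} {μ : V →ₗ[ℂ] (E →L[ℂ] E)}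
    {T : minTensor V H →L[ℂ] minTensor (⊤ : Submodule ℂ (E →L[ℂ] E)) H} (hT : IsAmpliation μ T)
    {A : ((i : Fin k) → FreeMonoid (Fin (n i))) → ((i : Fin k) → FreeMonoid (Fin (n i))) →
      (K →L[ℂ] K)} (hA : ∀ α β, A α β ∈ V) (X : OpTuple n H) (m : Fin k → ℤ) :
    (T ⟨homogTerm A X m, homogTerm_mem_minTensor hA X m⟩ : HTensor E H →L[ℂ] HTensor E H) =
      homogTerm (fun α β => μ ⟨A α β, hA α β⟩) X m := by
  have h : (⟨homogTerm A X m, homogTerm_mem_minTensor hA X m⟩ : minTensor V H) =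
      ∑ a : (i : Fin k) → Fin (-(m i)).toNat → Fin (n i),
        ∑ b : (i : Fin k) → Fin (m i).toNat → Fin (n i),
          ⟨_, opTensor_mem_minTensor ⟨_, hA (wordsOf a) (wordsOf b)⟩
            (wordProd X (wordsOf a) * wordProdStar X (wordsOf b))⟩ := by
    refine Subtype.ext ?_
    simp only [homogTerm, AddSubmonoidClass.coe_finsetSum]
  rw [h]
  simp only [map_sum, AddSubmonoidClass.coe_finsetSum]
  exact Finset.sum_congr rfl fun a _ => Finset.sum_congr rfl fun b _ =>
    hT ⟨A (wordsOf a) (wordsOf b), hA _ _⟩ (wordProd X (wordsOf a) * wordProdStar X (wordsOf b))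

theorem hasSum_poissonTransform {μ : starSpan n →ₗ[ℂ] (E →L[ℂ] E)} (hμ : IsCompletelyBounded μ)
    {X : OpTuple n H} (hX : IsInPolyball X) :
    HasSum (homogTerm (fun α β => μ ⟨poissonCoeff n α β, poissonCoeff_mem_starSpan α β⟩) X)
      (poissonTransform μ H X) := by
  have hmem := poissonKernel_mem_minTensor hX
  have h1 : HasSum (fun m => (⟨homogTerm (poissonCoeff n) X m,
      homogTerm_mem_minTensor poissonCoeff_mem_starSpan X m⟩ : minTensor (starSpan n) H))
      ⟨poissonKernel H X, hmem⟩ := by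
    have h := hasSum_poissonKernel hX
    rw [HasSum] at h ⊢
    refine tendsto_subtype_rng.2 (h.congr fun s => ?_)
    simp
  have h2 := (h1.mapL (ampliation μ H)).mapL (minTensor (⊤ : Submodule ℂ (E →L[ℂ] E)) H).subtypeL
  have e : (fun m => (minTensor (⊤ : Submodule ℂ (E →L[ℂ] E)) H).subtypeL (ampliation μ H
      ⟨homogTerm (poissonCoeff n) X m,
        homogTerm_mem_minTensor poissonCoeff_mem_starSpan X m⟩)) =
      homogTerm (fun α β => μ ⟨poissonCoeff n α β, poissonCoeff_mem_starSpan α β⟩) X :=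
    funext fun m => (isAmpliation_ampliation hμ H).apply_homogTerm poissonCoeff_mem_starSpan X m
  rw [e] at h2
  rw [poissonTransform, ampliationAt, dif_pos hmem]
  exact h2

end Transform

end Polyball

theorem mainTheorem8 {k : ℕ} (hk : 1 ≤ k) (n : Fin k → ℕ) (hn : ∀ i, 1 ≤ n i)
    (E : Type v) [NormedAddCommGroup E] [InnerProductSpace ℂ E] [CompleteSpace E]
    (μ : Polyball.starSpan n →ₗ[ℂ] (E →L[ℂ] E)) (hμ : Polyball.IsCompletelyBounded μ) :
    -- the Poisson kernel: norm convergence of its series, pluriharmonicity, positivity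
    (Polyball.HasPluriharmonicExpansion (Polyball.poissonCoeff n)
        (fun (H : Type u) _ _ _ (X : Polyball.OpTuple n H) => Polyball.poissonKernel H X) ∧
      Polyball.IsFreePluriharmonic
        (fun (H : Type u) _ _ _ (X : Polyball.OpTuple n H) => Polyball.poissonKernel H X) ∧
      Polyball.IsPositiveOnPolyball
        (fun (H : Type u) _ _ _ (X : Polyball.OpTuple n H) => Polyball.poissonKernel H X) ∧
      -- the factorization, with inverses that exist
      ∀ (H : Type u) [NormedAddCommGroup H] [InnerProductSpace ℂ H] [CompleteSpace H]
        (X : Polyball.OpTuple n H), Polyball.IsInPolyball X →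
        (∀ i, IsUnit (Polyball.resolventOp X i)) ∧
        Polyball.poissonKernel H X = star (Polyball.cOp X) * Polyball.cOp X) ∧
    -- the Poisson transform: it is well defined, pluriharmonic and equal to the Berezin transform
    ((∀ (H : Type u) [NormedAddCommGroup H] [InnerProductSpace ℂ H] [CompleteSpace H],
        Polyball.IsAmpliation μ (Polyball.ampliation μ H)) ∧
      (∀ (H : Type u) [NormedAddCommGroup H] [InnerProductSpace ℂ H] [CompleteSpace H]
        (X : Polyball.OpTuple n H), Polyball.IsInPolyball X →
        Polyball.poissonKernel H X ∈ Polyball.minTensor (Polyball.starSpan n) H) ∧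
      Polyball.IsFreePluriharmonic
        (fun (H : Type u) _ _ _ (X : Polyball.OpTuple n H) => Polyball.poissonTransform μ H X) ∧
      (∀ (H : Type u) [NormedAddCommGroup H] [InnerProductSpace ℂ H] [CompleteSpace H]
        (X : Polyball.OpTuple n H), Polyball.IsInPolyball X →
        Polyball.poissonTransform μ H X = Polyball.berezinTransform μ 1 H X) ∧
      -- the same for every completely bounded extension of `μ` to all bounded operators
      ∀ ν : (⊤ : Submodule ℂ (Polyball.Fock n →L[ℂ] Polyball.Fock n)) →ₗ[ℂ] (E →L[ℂ] E),
        Polyball.IsCompletelyBounded ν →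
        (∀ A : Polyball.starSpan n, ν ⟨(A : Polyball.Fock n →L[ℂ] Polyball.Fock n), trivial⟩ = μ A) →
        ∀ (H : Type u) [NormedAddCommGroup H] [InnerProductSpace ℂ H] [CompleteSpace H]
          (X : Polyball.OpTuple n H), Polyball.IsInPolyball X →
          Polyball.poissonTransform μ H X = Polyball.berezinTransform ν 1 H X) ∧
    -- positivity
    (Polyball.IsCompletelyPositive μ →
      Polyball.IsFreePluriharmonic
        (fun (H : Type u) _ _ _ (X : Polyball.OpTuple n H) => Polyball.poissonTransform μ H X) ∧
      Polyball.IsPositiveOnPolyball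
        (fun (H : Type u) _ _ _ (X : Polyball.OpTuple n H) => Polyball.poissonTransform μ H X)) := by
  have hexp : Polyball.HasPluriharmonicExpansion (Polyball.poissonCoeff n)
      (fun (H : Type u) _ _ _ (X : Polyball.OpTuple n H) => Polyball.poissonKernel H X) :=
    fun H _ _ _ X hX => Polyball.hasSum_poissonKernel hX
  have htr : Polyball.IsFreePluriharmonic
      (fun (H : Type u) _ _ _ (X : Polyball.OpTuple n H) => Polyball.poissonTransform μ H X) :=
    ⟨_, fun H _ _ _ X hX => Polyball.hasSum_poissonTransform hμ hX⟩
  refine ⟨⟨hexp, ⟨_, hexp⟩, fun H _ _ _ X hX => Polyball.isPositive_poissonKernel hX,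
    fun H _ _ _ X hX => ⟨(Polyball.isUnit_resolventOp_and_hasSum hX).1,
      Polyball.poissonKernel_eq hX⟩⟩,
    ⟨fun H _ _ _ => Polyball.isAmpliation_ampliation hμ H,
      fun H _ _ _ X hX => Polyball.poissonKernel_mem_minTensor hX, htr,
      fun H _ _ _ X hX => ?_, fun ν hν hext H _ _ _ X hX => ?_⟩,
    fun hcp => ⟨htr, fun H _ _ _ X hX => ?_⟩⟩
  · rw [Polyball.poissonTransform, Polyball.berezinTransform, Polyball.opTensor_one, mul_one,
      Polyball.poissonKernel_eq hX]
  · rw [Polyball.poissonTransform, Polyball.berezinTransform, Polyball.opTensor_one, mul_one,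
      ← Polyball.poissonKernel_eq hX]
    exact Polyball.ampliationAt_eq_of_extends le_top hμ hν hext
      (Polyball.poissonKernel_mem_minTensor hX)
  · have hmem := Polyball.poissonKernel_mem_minTensor hX
    change (Polyball.poissonTransform μ H X).IsPositive
    rw [Polyball.poissonTransform, Polyball.ampliationAt, dif_pos hmem]
    exact (Polyball.isAmpliation_ampliation hμ H).isPositive hcp Polyball.one_mem_starSpan
      (fun A hA => Polyball.star_mem_starSpan hA) ⟨_, hmem⟩ (Polyball.isPositive_poissonKernel hX)
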